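/- Let $n\ge 1$, $0<\alpha<1$ and $1\le p\le\infty$. For $t>0$ let $e^{-t(-\Delta)^\alpha}$ be the fractional heat semigroup on $L^p(\mathbb R^n)$, given by $\mathcal F(e^{-t(-\Delta)^\alpha}f)(\xi)=e^{-t|\xi|^{2\alpha}}\mathcal F f(\xi)$ (in the sense of tempered distributions: with $m_t(\xi)=e^{-t|\xi|^{2\alpha}}$, $u=e^{-t(-\Delta)^\alpha}f$ is the $u\in L^p(\mathbb R^n)$ such that $\int u\,\mathcal F\psi=\int f\,\mathcal F(m_t\psi)$ for all Schwartz functions $\psi$), where $\mathcal F g(\xi)=\int_{\mathbb R^n} g(x)e^{-ix\cdot\xi}\,dx$. Let $$e^{-t(-\Delta)^\alpha}(y)=(2\pi)^{-n}\int_{\mathbb R^n}e^{iy\cdot\xi}e^{-t|\xi|^{2\alpha}}\,d\xi,\qquad y\in\mathbb R^n,$$ be its kernel. Let $\{v_j\}_{j\in\mathbb Z}$ be a bounded sequence of real numbers, let $\{a_j\}_{j\in\mathbb Z}$ be an increasing (not necessarily strictly) sequence of positive numbers, and for $N=(N_1,N_2)\in\mathbb Z^2$ with $N_1<N_2$ put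 $$T_Nf=\sum_{j=N_1}^{N_2}v_j\bigl(e^{-a_{j+1}(-\Delta)^\alpha}f-e^{-a_j(-\Delta)^\alpha}f\bigr),\qquad K_N(y)=\sum_{j=N_1}^{N_2}v_j\bigl(e^{-a_{j+1}(-\Delta)^\alpha}(y)-e^{-a_j(-\Delta)^\alpha}(y)\bigr).$$ Then for every $f\in L^p(\mathbb R^n)$ the functions $e^{-a_j(-\Delta)^\alpha}f$ are well defined and, for almost every $x\in\mathbb R^n$, $$T_Nf(x)=\int_{\mathbb R^n}K_N(y)f(x-y)\,dy,$$ the integral being absolutely convergent. Moreover, there is a constant $C>0$ that depends only on $n$, $\alpha$ and an upper bound for $\|v\|_{\ell^\infty(\mathbb Z)}$ (not on $N$, $v$ or $\{a_j\}$ otherwise) such that, for every $y\neq0$, $K_N$ is differentiable at $y$ and $$|K_N(y)|\le\frac{C}{|y|^{n}},\qquad |\nabla_yK_N(y)|\le\frac{C}{|y|^{n+1}}.$$ -/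

import Mathlib

open MeasureTheory
open scoped ENNReal FourierTransform SchwartzMap ComplexConjugate

noncomputable section

/-- The space `ℝⁿ` with its Euclidean norm and Lebesgue measure. -/
abbrev Rn (n : ℕ) : Type := EuclideanSpace ℝ (Fin n)

/-- The multiplier of `e^{-t(-Δ)^α}`. Mathlib's Fourier transform has the phase `e^{-2πi⟨x,ξ⟩}`, so
the frequency variable that makes `-Δ` multiplication by `|·|²` is `2πξ`. -/
def fracHeatSymbol {n : ℕ} (α t : ℝ) (ξ : Rn n) : ℝ :=
  Real.exp (-t * (2 * Real.pi * ‖ξ‖) ^ (2 * α))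

/-- The kernel `e^{-t(-Δ)^α}(x)`: the inverse Fourier transform of the multiplier. It is a real
function by `ofReal_fracHeatKernel`. -/
def fracHeatKernel {n : ℕ} (α t : ℝ) (x : Rn n) : ℝ :=
  (𝓕⁻ (fun ξ : Rn n => (fracHeatSymbol α t ξ : ℂ)) x).re

theorem ofReal_fracHeatKernel {n : ℕ} (α t : ℝ) (x : Rn n) :
    (fracHeatKernel α t x : ℂ) = 𝓕⁻ (fun ξ : Rn n => (fracHeatSymbol α t ξ : ℂ)) x := by
  unfold fracHeatKernel
  rw [← Complex.conj_eq_iff_re, Real.fourierInv_eq', ← integral_conj,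
    ← integral_neg_eq_self]
  refine integral_congr_ae (Filter.Eventually.of_forall fun ξ => ?_)
  simp [fracHeatSymbol, ← Complex.exp_conj, Complex.conj_ofNat]

/-- `u = e^{-t(-Δ)^α} f` in `Lᵖ(ℝⁿ)`: `u ∈ Lᵖ` and `𝓕 u = e^{-t|·|^{2α}} 𝓕 f`, both sides read as
tempered distributions, that is `⟨𝓕 u, ψ⟩ = ∫ u 𝓕ψ` and `⟨m 𝓕 f, ψ⟩ = ∫ f 𝓕(m ψ)` for every Schwartz
function `ψ`. -/
structure IsFracHeat {n : ℕ} (p : ℝ≥0∞) (α t : ℝ) (f u : Rn n → ℂ) : Prop where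
  memLp : MemLp u p volume
  fourier_eq : ∀ ψ : 𝓢(Rn n, ℂ),
    ∫ x, u x * 𝓕 (fun ξ : Rn n => ψ ξ) x =
      ∫ x, f x * 𝓕 (fun ξ : Rn n => (fracHeatSymbol α t ξ : ℂ) * ψ ξ) x

open Classical in
/-- The operator `e^{-t(-Δ)^α}` on `Lᵖ(ℝⁿ)`, as a function determined almost everywhere. -/
def fracHeat {n : ℕ} (p : ℝ≥0∞) (α t : ℝ) (f : Rn n → ℂ) : Rn n → ℂ :=
  if h : ∃ u, IsFracHeat p α t f u then h.choose else 0

/-- `T_N f = ∑_{j=N₁}^{N₂} v_j (e^{-a_{j+1}(-Δ)^α} f - e^{-a_j(-Δ)^α} f)`. -/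
def diffTransform {n : ℕ} (p : ℝ≥0∞) (α : ℝ) (v a : ℤ → ℝ) (N : ℤ × ℤ) (f : Rn n → ℂ)
    (x : Rn n) : ℂ :=
  ∑ j ∈ Finset.Icc N.1 N.2,
    (v j : ℂ) * (fracHeat p α (a (j + 1)) f x - fracHeat p α (a j) f x)

/-- `K_N(y) = ∑_{j=N₁}^{N₂} v_j (e^{-a_{j+1}(-Δ)^α}(y) - e^{-a_j(-Δ)^α}(y))`. -/
def diffKernel {n : ℕ} (α : ℝ) (v a : ℤ → ℝ) (N : ℤ × ℤ) (y : Rn n) : ℝ :=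
  ∑ j ∈ Finset.Icc N.1 N.2,
    v j * (fracHeatKernel α (a (j + 1)) y - fracHeatKernel α (a j) y)

end

/-! The kernel bounds come from subordination to the Gauss-Weierstrass kernel. At a fixed `y ≠ 0`
the heat kernel, as a function of time, rises to a maximum of order `|y|^{-n}` and then falls, so
its total variation along any increasing sequence of times is at most twice that maximum. Each
component of its gradient behaves the same way, at order `|y|^{-(n+1)}`. Multipliers `v_j` bounded
by `M` cost only a factor `M`. These bounds survive averaging over dilations of time, and
`exp(-λ^α)` is the Laplace transform of a probability law (the one-sided stable law), so they pass
to the fractional kernels.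

The stable law itself is never constructed. `stable_induction` approximates `exp(-λ^α)` by
polynomials in `e^{-hλ}` with nonnegative coefficients: truncated Laplace transforms of sums of
shifted Sibuya variables, suitably rescaled. Such a polynomial corresponds to a finite mixture of
heat kernels (`isSubordinate_mixture`), and every property in `IsSubordinate` is closed under
dominated limits of symbols (`IsSubordinate.of_tendsto`). The result is `isSubordinate_stable`,
which also gives positivity and mass at most one.

Integrability of the kernel then gives Fourier inversion and Young's inequality, so convolution with
the kernel realises the operator on `L^p`; the distributional identity determines it almost
everywhere (`ae_eq_of_integral_mul_fourier_eq`). -/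

/-! ### Approximation of the stable law by rescaled Sibuya sums. -/

/-- The probabilities of the Sibuya law of parameter `α`, shifted by one: the coefficient of
`z ^ (j + 1)` in `1 - (1 - z) ^ α`. -/
noncomputable def sibuya (α : ℝ) (j : ℕ) : ℝ := (-1) ^ j * Ring.choose α (j + 1)

theorem Ring.choose_real_succ (a : ℝ) (j : ℕ) :
    Ring.choose a (j + 1) = Ring.choose a j * (a - j) / (j + 1) := by
  rw [Ring.choose_eq_smul, Ring.choose_eq_smul, descPochhammer_succ_right, Polynomial.smeval_mul]
  have h1 : ((j : ℝ) + 1) ≠ 0 := by positivity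
  have h2 : ((Nat.factorial j : ℕ) : ℝ) ≠ 0 := by positivity
  simp only [Nat.factorial_succ, Nat.cast_mul, Nat.cast_add, Nat.cast_one, Polynomial.smeval_sub,
    Polynomial.smeval_X, Polynomial.smeval_natCast, pow_one, pow_zero, smul_eq_mul, nsmul_eq_mul,
    mul_one]
  field_simp

/-- The first coefficient is `α` and consecutive ones have ratio `(j + 1 - α) / (j + 2)`, which is
positive because `α < 1`. -/
theorem sibuya_nonneg {α : ℝ} (h0 : 0 < α) (h1 : α < 1) (j : ℕ) : 0 ≤ sibuya α j := by
  induction j with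
  | zero => simp [sibuya, h0.le]
  | succ j ih =>
    have : sibuya α (j + 1) = sibuya α j * ((j + 1 - α) / (j + 2)) := by
      unfold sibuya
      rw [Ring.choose_real_succ α (j + 1)]
      have h2 : ((j : ℝ) + 2) ≠ 0 := by positivity
      push_cast
      field_simp
      ring
    rw [this]
    have hj : (0 : ℝ) ≤ j := j.cast_nonneg
    exact mul_nonneg ih (div_nonneg (by linarith) (by positivity))

theorem hasSum_sibuya (α : ℝ) {z : ℝ} (hz0 : 0 ≤ z) (hz1 : z < 1) :
    HasSum (fun j => sibuya α j * z ^ (j + 1)) (1 - (1 - z) ^ α) := by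
  have hz : -z ∈ Metric.eball (0 : ℝ) 1 := by
    rw [← ENNReal.ofReal_one, Metric.eball_ofReal]
    simpa [abs_of_nonneg hz0] using hz1
  have h := (Real.one_add_rpow_hasFPowerSeriesOnBall_zero (a := α)).hasSum hz
  rw [← hasSum_nat_add_iff' 1] at h
  have h' := h.neg
  simp only [zero_add, binomialSeries_apply, List.ofFn_const, List.prod_replicate, smul_eq_mul,
    Finset.range_one, Finset.sum_singleton, Ring.choose_zero_right, pow_zero, mul_one,
    neg_sub] at h'
  have e : (fun j => sibuya α j * z ^ (j + 1)) =
      fun j => -(Ring.choose α (j + 1) * (-z) ^ (j + 1)) := by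
    funext j
    unfold sibuya
    rw [neg_pow z, pow_succ (-1 : ℝ)]
    ring
  rw [e, sub_eq_add_neg 1 z]
  exact h'

/-- The truncated generating function of one plus a Sibuya variable. -/
noncomputable def sibuyaPoly (α : ℝ) (J : ℕ) : Polynomial ℝ :=
  ∑ j ∈ Finset.range J, Polynomial.C (sibuya α j) * Polynomial.X ^ (j + 2)

theorem sibuyaPoly_eval (α : ℝ) (J : ℕ) (z : ℝ) :
    (sibuyaPoly α J).eval z = z * ∑ j ∈ Finset.range J, sibuya α j * z ^ (j + 1) := by
  simp only [sibuyaPoly, Polynomial.eval_finsetSum, Polynomial.eval_mul, Polynomial.eval_C,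
    Polynomial.eval_pow, Polynomial.eval_X, Finset.mul_sum]
  exact Finset.sum_congr rfl fun j _ => by ring

theorem sibuyaPoly_coeff_nonneg {α : ℝ} (h0 : 0 < α) (h1 : α < 1) (J i : ℕ) :
    0 ≤ (sibuyaPoly α J).coeff i := by
  simp only [sibuyaPoly, Polynomial.finsetSum_coeff, Polynomial.coeff_C_mul_X_pow]
  refine Finset.sum_nonneg fun j _ => ?_
  split_ifs
  · exact sibuya_nonneg h0 h1 j
  · exact le_rfl

theorem sibuyaPoly_eval_le {α : ℝ} (h0 : 0 < α) (h1 : α < 1) (J : ℕ) {z : ℝ} (hz0 : 0 ≤ z)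
    (hz1 : z < 1) : (sibuyaPoly α J).eval z ≤ z * (1 - (1 - z) ^ α) := by
  rw [sibuyaPoly_eval]
  gcongr
  exact sum_le_hasSum _ (fun j _ => mul_nonneg (sibuya_nonneg h0 h1 j) (by positivity))
    (hasSum_sibuya α hz0 hz1)

theorem sibuyaPoly_eval_nonneg {α : ℝ} (h0 : 0 < α) (h1 : α < 1) (J : ℕ) {z : ℝ} (hz0 : 0 ≤ z) :
    0 ≤ (sibuyaPoly α J).eval z := by
  rw [sibuyaPoly_eval]
  exact mul_nonneg hz0 (Finset.sum_nonneg fun j _ =>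
    mul_nonneg (sibuya_nonneg h0 h1 j) (by positivity))

/-- The binomial series is only summed for `z < 1`; the value at `1` is reached by continuity of the
polynomial. -/
theorem sibuyaPoly_eval_one_le {α : ℝ} (h0 : 0 < α) (h1 : α < 1) (J : ℕ) :
    (sibuyaPoly α J).eval 1 ≤ 1 := by
  have hc : Filter.Tendsto (fun z => (sibuyaPoly α J).eval z) (nhdsWithin 1 (Set.Iio 1))
      (nhds ((sibuyaPoly α J).eval 1)) :=
    ((sibuyaPoly α J).continuous.tendsto 1).mono_left nhdsWithin_le_nhds
  refine le_of_tendsto hc ?_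
  filter_upwards [self_mem_nhdsWithin,
    mem_nhdsWithin_of_mem_nhds (Ioi_mem_nhds (zero_lt_one' ℝ))] with z hz1 hz0
  have hz1' : z < 1 := hz1
  have hz0' : 0 < z := hz0
  refine (sibuyaPoly_eval_le h0 h1 J hz0'.le hz1').trans ?_
  have : 0 ≤ (1 - z) ^ α := Real.rpow_nonneg (by linarith) _
  nlinarith

theorem tendsto_sibuyaPoly_eval (α : ℝ) {z : ℝ} (hz0 : 0 ≤ z) (hz1 : z < 1) :
    Filter.Tendsto (fun J => (sibuyaPoly α J).eval z) Filter.atTop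
      (nhds (z * (1 - (1 - z) ^ α))) := by
  simp only [sibuyaPoly_eval]
  exact (hasSum_sibuya α hz0 hz1).tendsto_sum_nat.const_mul z

theorem Polynomial.coeff_pow_nonneg {q : Polynomial ℝ} (hq : ∀ i, 0 ≤ q.coeff i) (k i : ℕ) :
    0 ≤ (q ^ k).coeff i := by
  induction k generalizing i with
  | zero => rw [pow_zero, Polynomial.coeff_one]; split_ifs <;> norm_num
  | succ k ih =>
    rw [pow_succ, Polynomial.coeff_mul]
    exact Finset.sum_nonneg fun x _ => mul_nonneg (ih _) (hq _)

/-- The Laplace transform of one plus a Sibuya variable. -/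
noncomputable def sibuyaLaplace (α x : ℝ) : ℝ := Real.exp (-x) * (1 - (1 - Real.exp (-x)) ^ α)

theorem sibuyaLaplace_nonneg {α x : ℝ} (h0 : 0 < α) (hx : 0 < x) : 0 ≤ sibuyaLaplace α x := by
  have h1 : Real.exp (-x) < 1 := by simpa using hx
  have := Real.rpow_le_one (x := 1 - Real.exp (-x)) (by linarith)
    (by linarith [Real.exp_pos (-x)]) h0.le
  exact mul_nonneg (Real.exp_pos _).le (by linarith)

/-- For `x ≥ 1` the factor `e^{-x}`, due to the shift by one, gives the decay since `x^α ≤ x`. For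
`x < 1` the Sibuya factor does, through `1 - e^{-x} ≥ x / 2` and `2^α ≤ 2`. -/
theorem sibuyaLaplace_le {α x : ℝ} (h0 : 0 < α) (h1 : α < 1) (hx : 0 < x) :
    sibuyaLaplace α x ≤ Real.exp (-(x ^ α) / 2) := by
  set u := 1 - Real.exp (-x) with hu
  have hu0 : 0 < u := by have : Real.exp (-x) < 1 := by simpa using hx
                         linarith
  have key : x ^ α / 2 ≤ x + u ^ α := by
    rcases le_or_gt 1 x with h | h
    · have : x ^ α ≤ x := by simpa using Real.rpow_le_rpow_of_exponent_le h h1.le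
      have := Real.rpow_nonneg hu0.le α
      linarith
    · have h2 : x / 2 ≤ u := by
        have h3 : Real.exp (-x) ≤ 1 / (1 + x) := by
          rw [Real.exp_neg, ← one_div]
          exact one_div_le_one_div_of_le (by linarith) (by linarith [Real.add_one_le_exp x])
        have h4 : 1 / (1 + x) ≤ 1 - x / 2 := by
          rw [div_le_iff₀ (by linarith)]; nlinarith
        linarith
      have h3 : (x / 2) ^ α ≤ u ^ α := Real.rpow_le_rpow (by linarith) h2 h0.le
      rw [Real.div_rpow hx.le (by norm_num)] at h3
      have h4 : (2 : ℝ) ^ α ≤ 2 := by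
        simpa using Real.rpow_le_rpow_of_exponent_le (by norm_num : (1 : ℝ) ≤ 2) h1.le
      have h5 : x ^ α / 2 ≤ x ^ α / 2 ^ α := by
        gcongr
      linarith
  calc sibuyaLaplace α x = Real.exp (-x) * (1 - u ^ α) := rfl
    _ ≤ Real.exp (-x) * Real.exp (-u ^ α) := by
        gcongr
        linarith [Real.add_one_le_exp (-u ^ α)]
    _ = Real.exp (-x + -u ^ α) := (Real.exp_add _ _).symm
    _ ≤ _ := Real.exp_le_exp.2 (by linarith)

/-- With `u = 1 - e^{-x}`, the numerator is `u + e^{-x} u^α`. Since `α < 1`, the term `u ~ x` is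
negligible against `x^α`, so the shift by one is invisible in the limit. -/
theorem tendsto_one_sub_sibuyaLaplace {α : ℝ} (h1 : α < 1) :
    Filter.Tendsto (fun x => (1 - sibuyaLaplace α x) / x ^ α) (nhdsWithin 0 (Set.Ioi 0))
      (nhds 1) := by
  have hs : Filter.Tendsto (fun x : ℝ => (1 - Real.exp (-x)) / x) (nhdsWithin 0 (Set.Ioi 0))
      (nhds 1) := by
    have hd : HasDerivAt (fun x : ℝ => 1 - Real.exp (-x)) 1 0 := by
      have := ((hasDerivAt_neg (0 : ℝ)).exp).const_sub 1
      simpa using this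
    have := hd.tendsto_slope_zero_right
    refine this.congr fun x => ?_
    simp [div_eq_inv_mul]
  have he : Filter.Tendsto (fun x : ℝ => Real.exp (-x)) (nhdsWithin 0 (Set.Ioi 0)) (nhds 1) := by
    have : Continuous fun x : ℝ => Real.exp (-x) := by fun_prop
    simpa using (this.tendsto 0).mono_left nhdsWithin_le_nhds
  have hp : Filter.Tendsto (fun x : ℝ => x ^ (1 - α)) (nhdsWithin 0 (Set.Ioi 0)) (nhds 0) := by
    have : Continuous fun x : ℝ => x ^ (1 - α) := Real.continuous_rpow_const (by linarith)
    simpa [Real.zero_rpow (by linarith : 1 - α ≠ 0)] using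
      (this.tendsto 0).mono_left nhdsWithin_le_nhds
  have hr := hs.rpow_const (p := α) (Or.inl one_ne_zero)
  have := (hs.mul hp).add (he.mul hr)
  simp only [mul_zero, Real.one_rpow, mul_one, zero_add] at this
  refine this.congr' ?_
  filter_upwards [self_mem_nhdsWithin] with x hx
  have hx : 0 < x := hx
  have hu : 0 ≤ 1 - Real.exp (-x) := by
    have : Real.exp (-x) < 1 := by simpa using hx
    linarith
  unfold sibuyaLaplace
  rw [Real.div_rpow hu hx.le, Real.rpow_sub hx, Real.rpow_one]
  have : x ^ α ≠ 0 := (Real.rpow_pos_of_pos hx α).ne'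
  field_simp
  ring

/-- At `x = k^{-1/α} l` one has `x^α = l^α / k`, so the base is `1 - l^α / k + o(1/k)` and its
`k`-th power tends to the exponential. -/
theorem tendsto_sibuyaLaplace_pow {α : ℝ} (h0 : 0 < α) (h1 : α < 1) {l : ℝ} (hl : 0 < l) :
    Filter.Tendsto (fun k : ℕ => sibuyaLaplace α ((k : ℝ) ^ (-α⁻¹) * l) ^ k) Filter.atTop
      (nhds (Real.exp (-l ^ α))) := by
  have hx : Filter.Tendsto (fun k : ℕ => (k : ℝ) ^ (-α⁻¹) * l) Filter.atTop
      (nhdsWithin 0 (Set.Ioi 0)) := by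
    refine tendsto_nhdsWithin_iff.2 ⟨?_, ?_⟩
    · simpa using ((tendsto_rpow_neg_atTop (inv_pos.2 h0)).comp
        tendsto_natCast_atTop_atTop).mul_const l
    · filter_upwards [Filter.eventually_gt_atTop 0] with k hk
      have : (0 : ℝ) < k := by exact_mod_cast hk
      exact mul_pos (Real.rpow_pos_of_pos this _) hl
  have hg : Filter.Tendsto
      (fun k : ℕ => (k : ℝ) * (sibuyaLaplace α ((k : ℝ) ^ (-α⁻¹) * l) - 1)) Filter.atTop
      (nhds (-l ^ α)) := by
    have := ((tendsto_one_sub_sibuyaLaplace h1).comp hx).const_mul (-l ^ α)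
    rw [mul_one] at this
    refine this.congr' ?_
    filter_upwards [Filter.eventually_gt_atTop 0] with k hk
    have hk : (0 : ℝ) < k := by exact_mod_cast hk
    have e : ((k : ℝ) ^ (-α⁻¹) * l) ^ α = (k : ℝ)⁻¹ * l ^ α := by
      rw [Real.mul_rpow (Real.rpow_nonneg hk.le _) hl.le, ← Real.rpow_mul hk.le, neg_mul,
        inv_mul_cancel₀ h0.ne', Real.rpow_neg_one]
    simp only [Function.comp, e]
    have : l ^ α ≠ 0 := (Real.rpow_pos_of_pos hl α).ne'
    field_simp
    ring
  have := Real.tendsto_one_add_pow_exp_of_tendsto hg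
  simpa using this

theorem sibuyaLaplace_pow_le {α : ℝ} (h0 : 0 < α) (h1 : α < 1) {l : ℝ} (hl : 0 < l) {k : ℕ}
    (hk : 0 < k) :
    sibuyaLaplace α ((k : ℝ) ^ (-α⁻¹) * l) ^ k ≤ Real.exp (-(l ^ α) / 2) := by
  have hk' : (0 : ℝ) < k := by exact_mod_cast hk
  have hx : 0 < (k : ℝ) ^ (-α⁻¹) * l := mul_pos (Real.rpow_pos_of_pos hk' _) hl
  have e : ((k : ℝ) ^ (-α⁻¹) * l) ^ α = (k : ℝ)⁻¹ * l ^ α := by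
    rw [Real.mul_rpow (Real.rpow_nonneg hk'.le _) hl.le, ← Real.rpow_mul hk'.le, neg_mul,
      inv_mul_cancel₀ h0.ne', Real.rpow_neg_one]
  calc _ ≤ Real.exp (-(((k : ℝ) ^ (-α⁻¹) * l) ^ α) / 2) ^ k :=
        pow_le_pow_left₀ (sibuyaLaplace_nonneg h0 hx) (sibuyaLaplace_le h0 h1 hx) _
    _ = _ := by
        rw [← Real.exp_nat_mul, e]
        congr 1
        field_simp

/-- A property of functions on `(0, ∞)` which holds for the Laplace transforms of finitely
supported subprobability measures on `h ℕ`, `h > 0`, and which is stable under dominated pointwise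
limits, holds for the Laplace transform `λ ↦ exp (-λ ^ α)` of the stable law. -/
theorem stable_induction {α : ℝ} (h0 : 0 < α) (h1 : α < 1) (P : (ℝ → ℝ) → Prop)
    (base : ∀ (q : Polynomial ℝ) (h : ℝ), (∀ i, 0 ≤ q.coeff i) → q.coeff 0 = 0 → q.eval 1 ≤ 1 →
      0 < h → P fun l => q.eval (Real.exp (-(h * l))))
    (lim : ∀ (F : ℕ → ℝ → ℝ) (G : ℝ → ℝ), (∀ k, Measurable (F k)) →
      (∀ k l, 0 < l → |F k l| ≤ Real.exp (-(l ^ α) / 2)) →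
      (∀ l, 0 < l → Filter.Tendsto (fun k => F k l) Filter.atTop (nhds (G l))) →
      (∀ k, P (F k)) → P G) :
    P fun l => Real.exp (-l ^ α) := by
  -- Two successive limits: here the truncation `J → ∞` at a fixed power, below the power tends to
  -- infinity. The exponent `k + 1` avoids the zeroth power, for which the constant coefficient
  -- would not vanish.
  have step : ∀ k : ℕ, P fun l =>
      sibuyaLaplace α (((k + 1 : ℕ) : ℝ) ^ (-α⁻¹) * l) ^ (k + 1) := by
    intro k
    set h : ℝ := ((k + 1 : ℕ) : ℝ) ^ (-α⁻¹) with hh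
    have hpos : 0 < h := Real.rpow_pos_of_pos (by positivity) _
    have hz : ∀ l, 0 < l → Real.exp (-(h * l)) < 1 := fun l hl => by
      simpa using mul_pos hpos hl
    refine lim (fun J l => ((sibuyaPoly α J) ^ (k + 1)).eval (Real.exp (-(h * l)))) _ ?_ ?_ ?_ ?_
    · intro J
      exact ((sibuyaPoly α J ^ (k + 1)).continuous.comp (by fun_prop)).measurable
    · intro J l hl
      rw [Polynomial.eval_pow, abs_of_nonneg
        (pow_nonneg (sibuyaPoly_eval_nonneg h0 h1 J (Real.exp_pos _).le) _)]
      refine le_trans ?_ (sibuyaLaplace_pow_le h0 h1 hl k.succ_pos)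
      exact pow_le_pow_left₀ (sibuyaPoly_eval_nonneg h0 h1 J (Real.exp_pos _).le)
        (sibuyaPoly_eval_le h0 h1 J (Real.exp_pos _).le (hz l hl)) _
    · intro l hl
      simp only [Polynomial.eval_pow]
      exact (tendsto_sibuyaPoly_eval α (Real.exp_pos _).le (hz l hl)).pow _
    · intro J
      refine base _ h (Polynomial.coeff_pow_nonneg (sibuyaPoly_coeff_nonneg h0 h1 J) _) ?_ ?_ hpos
      · rw [Polynomial.coeff_zero_eq_eval_zero, Polynomial.eval_pow, sibuyaPoly_eval]
        simp
      · rw [Polynomial.eval_pow]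
        exact pow_le_one₀ (sibuyaPoly_eval_nonneg h0 h1 J zero_le_one)
          (sibuyaPoly_eval_one_le h0 h1 J)
  refine lim _ _ ?_ ?_ ?_ step
  · intro k
    unfold sibuyaLaplace
    fun_prop
  · intro k l hl
    rw [abs_of_nonneg (pow_nonneg (sibuyaLaplace_nonneg h0
      (mul_pos (Real.rpow_pos_of_pos (by positivity) _) hl)) _)]
    exact sibuyaLaplace_pow_le h0 h1 hl k.succ_pos
  · intro l hl
    exact (tendsto_sibuyaLaplace_pow h0 h1 hl).comp (Filter.tendsto_add_atTop_nat 1)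

/-! ### Variation in time of unimodal profiles. -/

theorem Int.sum_Icc_sub (A : ℤ → ℝ) {m n : ℤ} (h : m ≤ n) :
    ∑ j ∈ Finset.Icc m n, (A (j + 1) - A j) = A (n + 1) - A m := by
  induction n, h using Int.leInduction with
  | base => simp
  | succ n hn ih =>
    have e : Finset.Icc m (n + 1) = insert (n + 1) (Finset.Icc m n) := by
      ext x; simp only [Finset.mem_Icc, Finset.mem_insert]; omega
    rw [e, Finset.sum_insert (by simp), ih]
    ring

theorem sum_abs_sub_le_of_monotone {A : ℤ → ℝ} (hA : Monotone A) {B : ℝ} (h0 : ∀ j, 0 ≤ A j)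
    (hB : ∀ j, A j ≤ B) {m n : ℤ} (h : m ≤ n) :
    ∑ j ∈ Finset.Icc m n, |A (j + 1) - A j| ≤ B := by
  have e : ∑ j ∈ Finset.Icc m n, |A (j + 1) - A j| = ∑ j ∈ Finset.Icc m n, (A (j + 1) - A j) :=
    Finset.sum_congr rfl fun j _ => abs_of_nonneg (sub_nonneg.2 (hA (by omega : j ≤ j + 1)))
  rw [e, Int.sum_Icc_sub A h]
  linarith [h0 m, hB (n + 1)]

theorem sum_abs_sub_le_of_antitone {A : ℤ → ℝ} (hA : Antitone A) {B : ℝ} (h0 : ∀ j, 0 ≤ A j)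
    (hB : ∀ j, A j ≤ B) {m n : ℤ} (h : m ≤ n) :
    ∑ j ∈ Finset.Icc m n, |A (j + 1) - A j| ≤ B := by
  have := sum_abs_sub_le_of_monotone (A := fun j => B - A j) (B := B)
    (fun i j hij => sub_le_sub_left (hA hij) B) (fun j => sub_nonneg.2 (hB j))
    (fun j => sub_le_self _ (h0 j)) h
  refine le_trans (le_of_eq (Finset.sum_congr rfl fun j _ => ?_)) this
  rw [abs_sub_comm]
  congr 1
  ring

/-- A nonnegative function on `(0, ∞)` which increases up to `c` and decreases from there on varies
by at most twice its maximum. -/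
theorem sum_abs_sub_le_of_unimodal {h : ℝ → ℝ} {c : ℝ} (hc : 0 < c)
    (hmono : MonotoneOn h (Set.Ioc 0 c)) (hanti : AntitoneOn h (Set.Ici c))
    (h0 : ∀ s, 0 < s → 0 ≤ h s) {a : ℤ → ℝ} (ha : Monotone a) (ha0 : ∀ j, 0 < a j) {m n : ℤ}
    (hmn : m ≤ n) : ∑ j ∈ Finset.Icc m n, |h (a (j + 1)) - h (a j)| ≤ 2 * h c := by
  -- Up to a constant, `h` is the sum of an increasing part, frozen after `c`, and a decreasing
  -- part, frozen before `c`; each varies by at most `h c`.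
  have hsplit : ∀ s, h s = h (min s c) + h (max s c) - h c := fun s => by
    rcases le_total s c with hs | hs <;> simp [hs]
  have hmin : ∀ j, min (a j) c ∈ Set.Ioc 0 c := fun j => ⟨lt_min (ha0 j) hc, min_le_right _ _⟩
  have hmax : ∀ j, max (a j) c ∈ Set.Ici c := fun j => Set.mem_Ici.2 (le_max_right _ _)
  have h1 := sum_abs_sub_le_of_monotone (A := fun j => h (min (a j) c)) (B := h c)
    (fun i j hij => hmono (hmin i) (hmin j) (min_le_min_right _ (ha hij)))
    (fun j => h0 _ (hmin j).1) (fun j => hmono (hmin j) ⟨hc, le_rfl⟩ (hmin j).2) hmn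
  have h2 := sum_abs_sub_le_of_antitone (A := fun j => h (max (a j) c)) (B := h c)
    (fun i j hij => hanti (hmax i) (hmax j) (max_le_max_right _ (ha hij)))
    (fun j => h0 _ (hc.trans_le (hmax j))) (fun j => hanti Set.self_mem_Ici (hmax j) (hmax j)) hmn
  calc _ ≤ ∑ j ∈ Finset.Icc m n, (|h (min (a (j + 1)) c) - h (min (a j) c)| +
        |h (max (a (j + 1)) c) - h (max (a j) c)|) := by
        refine Finset.sum_le_sum fun j _ => ?_
        rw [hsplit (a (j + 1)), hsplit (a j)]
        refine le_trans (le_of_eq ?_) (abs_add_le _ _)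
        congr 1
        ring
    _ ≤ 2 * h c := by rw [Finset.sum_add_distrib]; linarith

/-- The profile in time of the heat kernel. -/
noncomputable def heatProfile (β r s : ℝ) : ℝ := s ^ (-β) * Real.exp (-r / s)

theorem heatProfile_eq_exp {β r s : ℝ} (hs : 0 < s) :
    heatProfile β r s = Real.exp (-(β * Real.log s) - r / s) := by
  rw [heatProfile, Real.rpow_def_of_pos hs, ← Real.exp_add]
  congr 1
  ring

theorem heatProfile_nonneg (β r : ℝ) {s : ℝ} (hs : 0 < s) : 0 ≤ heatProfile β r s := by
  rw [heatProfile_eq_exp hs]; positivity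

/-- The logarithm of the profile is `-β log s - r / s`; the inequality `log x ≤ x - 1` at `x = t /
s` replaces a derivative computation. -/
theorem heatProfile_monotoneOn {β r : ℝ} (hβ : 0 < β) :
    MonotoneOn (heatProfile β r) (Set.Ioc 0 (r / β)) := by
  rintro s ⟨hs, -⟩ t ⟨ht, htc⟩ hst
  rw [heatProfile_eq_exp hs, heatProfile_eq_exp ht, Real.exp_le_exp]
  have h1 := Real.log_le_sub_one_of_pos (div_pos ht hs)
  rw [Real.log_div ht.ne' hs.ne'] at h1
  rw [le_div_iff₀ hβ] at htc
  have h2 : β * (t / s - 1) ≤ r / s - r / t := by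
    have : r / s - r / t - β * (t / s - 1) = (t - s) * (r - t * β) / (s * t) := by
      field_simp
    have h3 : 0 ≤ (t - s) * (r - t * β) / (s * t) :=
      div_nonneg (mul_nonneg (by linarith) (by linarith)) (by positivity)
    linarith
  nlinarith

theorem heatProfile_antitoneOn {β r : ℝ} (hβ : 0 < β) (hr : 0 < r) :
    AntitoneOn (heatProfile β r) (Set.Ici (r / β)) := by
  intro s hsc t htc hst
  have hs : 0 < s := (div_pos hr hβ).trans_le hsc
  have ht : 0 < t := hs.trans_le hst
  rw [heatProfile_eq_exp hs, heatProfile_eq_exp ht, Real.exp_le_exp]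
  have h1 := Real.log_le_sub_one_of_pos (div_pos hs ht)
  rw [Real.log_div hs.ne' ht.ne'] at h1
  rw [Set.mem_Ici, div_le_iff₀ hβ] at hsc
  have h2 : r / s - r / t ≤ β * (1 - s / t) := by
    have : β * (1 - s / t) - (r / s - r / t) = (t - s) * (s * β - r) / (s * t) := by
      field_simp
    have h3 : 0 ≤ (t - s) * (s * β - r) / (s * t) :=
      div_nonneg (mul_nonneg (by linarith) (by linarith)) (by positivity)
    linarith
  nlinarith

theorem heatProfile_peak_le {β r : ℝ} (hβ : 0 < β) (hr : 0 < r) :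
    heatProfile β r (r / β) ≤ β ^ β * r ^ (-β) := by
  have h1 : Real.exp (-r / (r / β)) ≤ 1 := Real.exp_le_one_iff.2 (by
    rw [neg_div]; exact neg_nonpos.2 (by positivity))
  calc heatProfile β r (r / β) ≤ (r / β) ^ (-β) * 1 := by
        unfold heatProfile
        gcongr
    _ = _ := by
        rw [Real.div_rpow hr.le hβ.le, Real.rpow_neg hβ.le]
        field_simp

theorem sum_abs_heatProfile_sub_le {β r : ℝ} (hβ : 0 < β) (hr : 0 < r) {a : ℤ → ℝ}
    (ha : Monotone a) (ha0 : ∀ j, 0 < a j) {m n : ℤ} (hmn : m ≤ n) :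
    ∑ j ∈ Finset.Icc m n, |heatProfile β r (a (j + 1)) - heatProfile β r (a j)| ≤
      2 * (β ^ β * r ^ (-β)) :=
  (sum_abs_sub_le_of_unimodal (div_pos hr hβ) (heatProfile_monotoneOn hβ)
    (heatProfile_antitoneOn hβ hr) (fun _ => heatProfile_nonneg β r) ha ha0 hmn).trans
    (mul_le_mul_of_nonneg_left (heatProfile_peak_le hβ hr) (by norm_num))

/-! ### Dominated limits and derivatives of Fourier transforms. -/

section FourierLimits

variable {V : Type*} [NormedAddCommGroup V] [InnerProductSpace ℝ V] [FiniteDimensional ℝ V]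
  [MeasurableSpace V] [BorelSpace V]

theorem Real.tendsto_fourier_of_dominated {E : Type*} [NormedAddCommGroup E] [NormedSpace ℂ E]
    {F : ℕ → V → E} {f : V → E} {g : V → ℝ} (hF : ∀ k, AEStronglyMeasurable (F k) volume)
    (hg : Integrable g) (hb : ∀ k, ∀ᵐ x, ‖F k x‖ ≤ g x)
    (hlim : ∀ᵐ x, Filter.Tendsto (fun k => F k x) Filter.atTop (nhds (f x))) (y : V) :
    Filter.Tendsto (fun k => 𝓕 (F k) y) Filter.atTop (nhds (𝓕 f y)) := by
  simp only [Real.fourier_eq']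
  refine tendsto_integral_of_dominated_convergence g (fun k => ?_) hg (fun k => ?_) ?_
  · exact AEStronglyMeasurable.smul (Continuous.aestronglyMeasurable (by fun_prop)) (hF k)
  · filter_upwards [hb k] with x hx
    rw [norm_smul, Complex.norm_exp_ofReal_mul_I, one_mul]
    exact hx
  · filter_upwards [hlim] with x hx
    exact hx.const_smul _

theorem Real.tendsto_fourier_fourierSMulRight_of_dominated {F : ℕ → V → ℂ} {f : V → ℂ} {g : V → ℝ}
    (hF : ∀ k, AEStronglyMeasurable (F k) volume) (hg : Integrable fun x => ‖x‖ * g x)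
    (hb : ∀ k, ∀ᵐ x, ‖F k x‖ ≤ g x)
    (hlim : ∀ᵐ x, Filter.Tendsto (fun k => F k x) Filter.atTop (nhds (f x))) (y : V) :
    Filter.Tendsto (fun k => 𝓕 (VectorFourier.fourierSMulRight (innerSL ℝ) (F k)) y) Filter.atTop
      (nhds (𝓕 (VectorFourier.fourierSMulRight (innerSL ℝ) f) y)) := by
  refine Real.tendsto_fourier_of_dominated (g := fun x => 2 * Real.pi * (‖x‖ * g x))
    (fun k => (hF k).fourierSMulRight) (hg.const_mul _) (fun k => ?_) ?_ y
  · filter_upwards [hb k] with x hx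
    rw [VectorFourier.norm_fourierSMulRight, innerSL_apply_norm, mul_assoc]
    gcongr
  · filter_upwards [hlim] with x hx
    unfold VectorFourier.fourierSMulRight
    refine Filter.Tendsto.const_smul ?_ _
    exact ((ContinuousLinearMap.smulRightL ℝ V ℂ (innerSL ℝ x)).continuous.tendsto (f x)).comp hx

theorem hasFDerivAt_re_fourier {f : V → ℂ} (hf : Integrable f)
    (hf' : Integrable fun x => ‖x‖ * ‖f x‖) (y : V) :
    HasFDerivAt (fun y => (𝓕 f y).re)
      (Complex.reCLM ∘L 𝓕 (VectorFourier.fourierSMulRight (innerSL ℝ) f) y) y :=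
  Complex.reCLM.hasFDerivAt.comp y (Real.hasFDerivAt_fourier hf hf' y)

end FourierLimits

/-! ### Radial symbols and the Gauss-Weierstrass kernel. -/

/-- The function with the radial Fourier transform `φ (|2πξ|²)`. -/
noncomputable def radialKernel {n : ℕ} (φ : ℝ → ℝ) (y : Rn n) : ℝ :=
  (𝓕 (fun ξ : Rn n => (φ ((2 * Real.pi * ‖ξ‖) ^ 2) : ℂ)) y).re

/-- Time `t` becomes the dilation by `t^{1/α}` of the single profile `exp(-l^α)`. The symbol is
even, so the forward and the inverse Fourier transforms agree. -/
theorem fracHeatKernel_eq_radialKernel {n : ℕ} {α t : ℝ} (h0 : 0 < α) (ht : 0 < t) :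
    fracHeatKernel (n := n) α t = radialKernel fun l => Real.exp (-(t ^ α⁻¹ * l) ^ α) := by
  funext y
  unfold fracHeatKernel radialKernel
  rw [Real.fourierInv_eq_fourier_comp_neg]
  refine congrArg (fun f : Rn n → ℂ => (𝓕 f y).re) (funext fun ξ => ?_)
  simp only [fracHeatSymbol, norm_neg]
  have e : (t ^ α⁻¹ * (2 * Real.pi * ‖ξ‖) ^ 2) ^ α = t * (2 * Real.pi * ‖ξ‖) ^ (2 * α) := by
    rw [Real.mul_rpow (by positivity) (by positivity), ← Real.rpow_mul ht.le,
      inv_mul_cancel₀ h0.ne', Real.rpow_one, ← Real.rpow_natCast,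
      ← Real.rpow_mul (by positivity)]
    simp
  rw [e, neg_mul]

/-- The Gauss-Weierstrass kernel. -/
noncomputable def gaussKernel {n : ℕ} (s : ℝ) (y : Rn n) : ℝ :=
  (4 * Real.pi) ^ (-(n / 2 : ℝ)) * heatProfile (n / 2) (‖y‖ ^ 2 / 4) s

theorem gaussKernel_eq {n : ℕ} {s : ℝ} (hs : 0 < s) (y : Rn n) :
    gaussKernel s y = (4 * Real.pi * s) ^ (-(n / 2 : ℝ)) * Real.exp (-(1 / (4 * s)) * ‖y‖ ^ 2) := by
  rw [gaussKernel, heatProfile, Real.mul_rpow (by positivity) hs.le, mul_assoc]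
  congr 3
  field_simp

theorem gaussKernel_nonneg {n : ℕ} {s : ℝ} (hs : 0 < s) (y : Rn n) : 0 ≤ gaussKernel s y := by
  rw [gaussKernel_eq hs]; positivity

theorem fourier_gauss {n : ℕ} {s : ℝ} (hs : 0 < s) (y : Rn n) :
    𝓕 (fun ξ : Rn n => (Real.exp (-(s * (2 * Real.pi * ‖ξ‖) ^ 2)) : ℂ)) y = gaussKernel s y := by
  have hb : 0 < 4 * Real.pi ^ 2 * s := by positivity
  have h := fourier_gaussian_innerProductSpace (V := Rn n) (b := ((4 * Real.pi ^ 2 * s : ℝ) : ℂ))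
    (by rw [Complex.ofReal_re]; exact hb) y
  have e : (fun ξ : Rn n => (Real.exp (-(s * (2 * Real.pi * ‖ξ‖) ^ 2)) : ℂ)) =
      fun ξ => Complex.exp (-((4 * Real.pi ^ 2 * s : ℝ) : ℂ) * ‖ξ‖ ^ 2) := by
    funext ξ
    push_cast
    ring_nf
  rw [e, h, gaussKernel_eq hs]
  have h1 : (Real.pi : ℂ) / ((4 * Real.pi ^ 2 * s : ℝ) : ℂ) = (((4 * Real.pi * s)⁻¹ : ℝ) : ℂ) := by
    rw [← Complex.ofReal_div]
    congr 1
    field_simp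
  have h2 : ((Module.finrank ℝ (Rn n) : ℂ) / 2) = ((n / 2 : ℝ) : ℂ) := by simp
  rw [h1, h2, ← Complex.ofReal_cpow (by positivity), Real.inv_rpow (by positivity),
    ← Real.rpow_neg (by positivity)]
  have h3 : -(Real.pi : ℂ) ^ 2 * ‖y‖ ^ 2 / ((4 * Real.pi ^ 2 * s : ℝ) : ℂ) =
      ((-(1 / (4 * s)) * ‖y‖ ^ 2 : ℝ) : ℂ) := by
    have : -(1 / (4 * s)) * ‖y‖ ^ 2 = -Real.pi ^ 2 * ‖y‖ ^ 2 / (4 * Real.pi ^ 2 * s) := by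
      field_simp
    rw [this]
    push_cast
    ring
  rw [h3]
  push_cast
  rfl

theorem integral_gaussKernel {n : ℕ} {s : ℝ} (hs : 0 < s) :
    ∫ y : Rn n, gaussKernel s y = 1 := by
  simp only [gaussKernel_eq hs]
  rw [integral_const_mul, GaussianFourier.integral_rexp_neg_mul_sq_norm (by positivity)]
  have : Real.pi / (1 / (4 * s)) = 4 * Real.pi * s := by field_simp
  rw [this, finrank_euclideanSpace_fin, ← Real.rpow_add (by positivity)]
  simp

theorem integrable_gaussKernel {n : ℕ} {s : ℝ} (hs : 0 < s) :
    Integrable (gaussKernel (n := n) s) := by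
  -- A non-integrable function has integral `0` by convention, whereas this one has integral `1`.
  by_contra h
  have := integral_gaussKernel (n := n) hs
  rw [integral_undef h] at this
  exact zero_ne_one this

/-- Differentiating in `y` brings out a factor `1 / s`, that is, it raises the exponent of the
profile by one. The gradient is therefore again controlled by a unimodal profile in time. -/
theorem hasFDerivAt_gaussKernel {n : ℕ} {s : ℝ} (hs : 0 < s) (y : Rn n) :
    HasFDerivAt (gaussKernel (n := n) s)
      ((-((4 * Real.pi) ^ (-(n / 2 : ℝ)) / 2 * heatProfile (n / 2 + 1) (‖y‖ ^ 2 / 4) s)) •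
        innerSL ℝ y) y := by
  have h1 : HasFDerivAt (fun y : Rn n => ‖y‖ ^ 2) (2 • innerSL ℝ y) y :=
    (hasStrictFDerivAt_norm_sq y).hasFDerivAt
  have h2 := ((h1.const_mul (-(1 / (4 * s)))).exp).const_mul ((4 * Real.pi * s) ^ (-(n / 2 : ℝ)))
  have e : gaussKernel (n := n) s = fun y => (4 * Real.pi * s) ^ (-(n / 2 : ℝ)) *
      Real.exp (-(1 / (4 * s)) * ‖y‖ ^ 2) := funext (gaussKernel_eq hs)
  rw [e]
  refine h2.congr_fderiv ?_
  ext v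
  have h3 : -(1 / (4 * s)) * ‖y‖ ^ 2 = -(‖y‖ ^ 2 / 4) / s := by field_simp
  simp only [smul_apply, smul_eq_mul, nsmul_eq_mul, innerSL_apply_apply, heatProfile]
  rw [h3, neg_add, Real.rpow_add hs, Real.mul_rpow (by positivity) hs.le, Real.rpow_neg_one]
  push_cast
  field_simp
  ring

theorem fderiv_gaussKernel_apply {n : ℕ} {s : ℝ} (hs : 0 < s) (y e : Rn n) :
    fderiv ℝ (gaussKernel (n := n) s) y e =
      -((4 * Real.pi) ^ (-(n / 2 : ℝ)) / 2 * inner ℝ y e) *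
        heatProfile (n / 2 + 1) (‖y‖ ^ 2 / 4) s := by
  rw [(hasFDerivAt_gaussKernel hs y).fderiv, smul_apply, innerSL_apply_apply, smul_eq_mul]
  ring

theorem integrable_norm_pow_mul_exp_neg_mul_rpow {n : ℕ} (hn : 1 ≤ n) (m : ℕ) {c p : ℝ}
    (hc : 0 < c) (hp : 0 < p) : Integrable fun ξ : Rn n => ‖ξ‖ ^ m * Real.exp (-c * ‖ξ‖ ^ p) := by
  have : Nonempty (Fin n) := ⟨⟨0, hn⟩⟩
  rw [integrable_fun_norm_addHaar (volume : Measure (Rn n))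
    (f := fun r : ℝ => r ^ m * Real.exp (-c * r ^ p))]
  refine (integrableOn_rpow_mul_exp_neg_mul_rpow (s := ((n - 1 + m : ℕ) : ℝ))
    (by linarith [(Nat.cast_nonneg (n - 1 + m) : (0 : ℝ) ≤ _)])
    hp hc).congr_fun (fun r _ => ?_) measurableSet_Ioi
  simp only [finrank_euclideanSpace_fin, Real.rpow_natCast, smul_eq_mul, pow_add, mul_assoc]

/-- The common bound of the symbols which approximate that of the fractional heat kernel. -/
noncomputable def symbolBound {n : ℕ} (α τ : ℝ) (ξ : Rn n) : ℝ :=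
  Real.exp (-((τ * (2 * Real.pi * ‖ξ‖) ^ 2) ^ α) / 2)

theorem symbolBound_eq {n : ℕ} {α τ : ℝ} (hτ : 0 < τ) (ξ : Rn n) :
    symbolBound α τ ξ = Real.exp (-((τ * (2 * Real.pi) ^ 2) ^ α / 2) * ‖ξ‖ ^ (2 * α)) := by
  rw [symbolBound, mul_pow, ← mul_assoc, Real.mul_rpow (by positivity) (by positivity),
    ← Real.rpow_natCast ‖ξ‖, ← Real.rpow_mul (norm_nonneg ξ)]
  congr 1
  push_cast
  ring

theorem integrable_norm_pow_mul_symbolBound {n : ℕ} (hn : 1 ≤ n) (m : ℕ) {α τ : ℝ} (h0 : 0 < α)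
    (hτ : 0 < τ) : Integrable fun ξ : Rn n => ‖ξ‖ ^ m * symbolBound α τ ξ := by
  simp only [symbolBound_eq hτ]
  exact integrable_norm_pow_mul_exp_neg_mul_rpow hn m
    (half_pos (Real.rpow_pos_of_pos (by positivity) _)) (by linarith)

theorem integrable_symbolBound {n : ℕ} (hn : 1 ≤ n) {α τ : ℝ} (h0 : 0 < α) (hτ : 0 < τ) :
    Integrable (symbolBound (n := n) α τ) := by
  simpa using integrable_norm_pow_mul_symbolBound hn 0 h0 hτ

theorem integrable_norm_mul_symbolBound {n : ℕ} (hn : 1 ≤ n) {α τ : ℝ} (h0 : 0 < α) (hτ : 0 < τ) :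
    Integrable fun ξ : Rn n => ‖ξ‖ * symbolBound α τ ξ := by
  simpa using integrable_norm_pow_mul_symbolBound hn 1 h0 hτ

/-- The bounds and limits of the approximating profiles are known only on `(0, ∞)`; this discards
the frequency `0`. -/
theorem ae_norm_pos {n : ℕ} (hn : 1 ≤ n) : ∀ᵐ ξ : Rn n, 0 < ‖ξ‖ := by
  have : Nonempty (Fin n) := ⟨⟨0, hn⟩⟩
  filter_upwards [compl_mem_ae_iff.2 (measure_singleton (0 : Rn n))] with ξ hξ
  exact norm_pos_iff.2 hξ

/-! ### Subordinate kernels and their stability under limits. -/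

/-- The properties of the kernels `y ↦ p_τ(y)`, `τ > 0`, with the radial Fourier transforms
`φ (τ |2πξ|²)` which subordination to the heat kernel gives: they are subprobability densities,
and the variation of `p_τ(y)` and of its gradient in `τ` is controlled by powers of `|y|`. -/
structure IsSubordinate (n : ℕ) (C : ℝ) (φ : ℝ → ℝ) : Prop where
  nonneg : ∀ τ, 0 < τ → ∀ y : Rn n, 0 ≤ radialKernel (fun l => φ (τ * l)) y
  mass : ∀ τ, 0 < τ → ∫⁻ y : Rn n, ENNReal.ofReal (radialKernel (fun l => φ (τ * l)) y) ≤ 1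
  size : ∀ (v a : ℤ → ℝ) (M : ℝ) (N₁ N₂ : ℤ) (y : Rn n), (∀ j, |v j| ≤ M) → (∀ j, 0 < a j) →
    Monotone a → N₁ ≤ N₂ → y ≠ 0 →
    |∑ j ∈ Finset.Icc N₁ N₂, v j * (radialKernel (fun l => φ (a (j + 1) * l)) y -
      radialKernel (fun l => φ (a j * l)) y)| ≤ M * C / ‖y‖ ^ n
  grad : ∀ (v a : ℤ → ℝ) (M : ℝ) (N₁ N₂ : ℤ) (y e : Rn n), (∀ j, |v j| ≤ M) → (∀ j, 0 < a j) →
    Monotone a → N₁ ≤ N₂ → y ≠ 0 →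
    |∑ j ∈ Finset.Icc N₁ N₂, v j * (fderiv ℝ (radialKernel fun l => φ (a (j + 1) * l)) y e -
      fderiv ℝ (radialKernel fun l => φ (a j * l)) y e)| ≤ M * C / ‖y‖ ^ (n + 1) * ‖e‖

section Limits

variable {n : ℕ} {α : ℝ} {φ : ℝ → ℝ}

theorem norm_symbol_le (hb : ∀ l, 0 < l → |φ l| ≤ Real.exp (-(l ^ α) / 2)) {τ : ℝ}
    (hτ : 0 < τ) {ξ : Rn n} (hξ : 0 < ‖ξ‖) :
    ‖(φ (τ * (2 * Real.pi * ‖ξ‖) ^ 2) : ℂ)‖ ≤ symbolBound α τ ξ := by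
  rw [Complex.norm_real, Real.norm_eq_abs]
  exact hb _ (by positivity)

theorem measurable_symbol (hφ : Measurable φ) (τ : ℝ) :
    Measurable fun ξ : Rn n => (φ (τ * (2 * Real.pi * ‖ξ‖) ^ 2) : ℂ) :=
  Complex.measurable_ofReal.comp (hφ.comp (by fun_prop))

theorem integrable_symbol (hn : 1 ≤ n) (h0 : 0 < α)
    (hφ : AEStronglyMeasurable (fun ξ : Rn n => (φ ((2 * Real.pi * ‖ξ‖) ^ 2) : ℂ)) volume) {τ : ℝ}
    (hτ : 0 < τ) (hb : ∀ᵐ ξ : Rn n, ‖(φ ((2 * Real.pi * ‖ξ‖) ^ 2) : ℂ)‖ ≤ symbolBound α τ ξ) :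
    Integrable (fun ξ : Rn n => (φ ((2 * Real.pi * ‖ξ‖) ^ 2) : ℂ)) ∧
    Integrable (fun ξ : Rn n => ‖ξ‖ * ‖(φ ((2 * Real.pi * ‖ξ‖) ^ 2) : ℂ)‖) := by
  refine ⟨(integrable_symbolBound hn h0 hτ).mono' hφ hb,
    (integrable_norm_mul_symbolBound hn h0 hτ).mono'
      (continuous_norm.aestronglyMeasurable.mul hφ.norm) ?_⟩
  filter_upwards [hb] with ξ hξ
  rw [norm_mul, norm_norm, norm_norm]
  gcongr

/-- The symbols have a common majorant that stays integrable after multiplication by `|ξ|`, so the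
kernels and their derivatives converge pointwise. Sign and variation bounds pass to the limit
because the sums over `j` are finite; the mass bound passes by Fatou's lemma. -/
theorem IsSubordinate.of_tendsto (hn : 1 ≤ n) (h0 : 0 < α) {C : ℝ} {F : ℕ → ℝ → ℝ}
    (hF : ∀ k, Measurable (F k)) (hb : ∀ k l, 0 < l → |F k l| ≤ Real.exp (-(l ^ α) / 2))
    (hlim : ∀ l, 0 < l → Filter.Tendsto (fun k => F k l) Filter.atTop (nhds (φ l)))
    (h : ∀ k, IsSubordinate n C (F k)) : IsSubordinate n C φ := by
  have hm : ∀ τ k, AEStronglyMeasurable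
      (fun ξ : Rn n => (F k (τ * (2 * Real.pi * ‖ξ‖) ^ 2) : ℂ)) volume := fun τ k =>
    (measurable_symbol (hF k) τ).aestronglyMeasurable
  have hbd : ∀ τ, 0 < τ → ∀ k, ∀ᵐ ξ : Rn n,
      ‖(F k (τ * (2 * Real.pi * ‖ξ‖) ^ 2) : ℂ)‖ ≤ symbolBound α τ ξ := fun τ hτ k => by
    filter_upwards [ae_norm_pos hn] with ξ hξ
    exact norm_symbol_le (hb k) hτ hξ
  have hl : ∀ τ, 0 < τ → ∀ᵐ ξ : Rn n, Filter.Tendsto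
      (fun k => (F k (τ * (2 * Real.pi * ‖ξ‖) ^ 2) : ℂ)) Filter.atTop
      (nhds (φ (τ * (2 * Real.pi * ‖ξ‖) ^ 2) : ℂ)) := fun τ hτ => by
    filter_upwards [ae_norm_pos hn] with ξ hξ
    exact (Complex.continuous_ofReal.tendsto _).comp (hlim _ (by positivity))
  have hmφ : ∀ τ, 0 < τ → AEStronglyMeasurable
      (fun ξ : Rn n => (φ (τ * (2 * Real.pi * ‖ξ‖) ^ 2) : ℂ)) volume := fun τ hτ =>
    aestronglyMeasurable_of_tendsto_ae Filter.atTop (hm τ) (hl τ hτ)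
  have hbφ : ∀ τ, 0 < τ → ∀ᵐ ξ : Rn n,
      ‖(φ (τ * (2 * Real.pi * ‖ξ‖) ^ 2) : ℂ)‖ ≤ symbolBound α τ ξ := fun τ hτ => by
    filter_upwards [hl τ hτ, ae_all_iff.2 (hbd τ hτ)] with ξ h1 h2
    exact le_of_tendsto' h1.norm h2
  have hiF : ∀ τ : ℝ, 0 < τ → ∀ k, _ := fun τ hτ k =>
    integrable_symbol (φ := fun l => F k (τ * l)) hn h0 (hm τ k) hτ (hbd τ hτ k)
  have hiφ : ∀ τ : ℝ, 0 < τ → _ := fun τ hτ =>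
    integrable_symbol (φ := fun l => φ (τ * l)) hn h0 (hmφ τ hτ) hτ (hbφ τ hτ)
  have hlimK : ∀ τ, 0 < τ → ∀ y : Rn n, Filter.Tendsto
      (fun k => radialKernel (fun l => F k (τ * l)) y) Filter.atTop
      (nhds (radialKernel (fun l => φ (τ * l)) y)) := fun τ hτ y =>
    (Complex.continuous_re.tendsto _).comp (Real.tendsto_fourier_of_dominated (hm τ)
      (integrable_symbolBound hn h0 hτ) (hbd τ hτ) (hl τ hτ) y)
  have hlimD : ∀ τ, 0 < τ → ∀ y e : Rn n, Filter.Tendsto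
      (fun k => fderiv ℝ (radialKernel fun l => F k (τ * l)) y e) Filter.atTop
      (nhds (fderiv ℝ (radialKernel fun l => φ (τ * l)) y e)) := fun τ hτ y e => by
    have e1 : ∀ k, fderiv ℝ (radialKernel fun l => F k (τ * l)) y = _ := fun k =>
      (hasFDerivAt_re_fourier (hiF τ hτ k).1 (hiF τ hτ k).2 y).fderiv
    have e2 : fderiv ℝ (radialKernel fun l => φ (τ * l)) y = _ :=
      (hasFDerivAt_re_fourier (hiφ τ hτ).1 (hiφ τ hτ).2 y).fderiv
    simp only [e1, e2]
    have hT := Real.tendsto_fourier_fourierSMulRight_of_dominated (hm τ)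
      (integrable_norm_mul_symbolBound hn h0 hτ) (hbd τ hτ) (hl τ hτ) y
    have hc : Continuous fun T : Rn n →L[ℝ] ℂ => (Complex.reCLM ∘L T) e := by fun_prop
    exact (hc.tendsto _).comp hT
  refine ⟨fun τ hτ y => ge_of_tendsto' (hlimK τ hτ y) fun k => (h k).nonneg τ hτ y,
    fun τ hτ => ?_, fun v a M N₁ N₂ y hv ha0 ha hN hy => ?_,
    fun v a M N₁ N₂ y e hv ha0 ha hN hy => ?_⟩
  · have hmeas : ∀ k, Measurable fun y : Rn n =>
        ENNReal.ofReal (radialKernel (fun l => F k (τ * l)) y) := fun k => by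
      have : Differentiable ℝ (radialKernel (n := n) fun l => F k (τ * l)) := fun y =>
        (hasFDerivAt_re_fourier (hiF τ hτ k).1 (hiF τ hτ k).2 y).differentiableAt
      exact ENNReal.measurable_ofReal.comp this.continuous.measurable
    calc _ = ∫⁻ y : Rn n, Filter.liminf (fun k =>
          ENNReal.ofReal (radialKernel (fun l => F k (τ * l)) y)) Filter.atTop := by
          refine lintegral_congr fun y => ?_
          exact ((ENNReal.continuous_ofReal.tendsto _).comp (hlimK τ hτ y)).liminf_eq.symm
      _ ≤ _ := lintegral_liminf_le hmeas
      _ ≤ 1 := by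
          refine (Filter.liminf_le_liminf (Filter.Eventually.of_forall fun k =>
            (h k).mass τ hτ)).trans ?_
          simp
  · refine le_of_tendsto' (Filter.Tendsto.abs (tendsto_finsetSum _ fun j _ =>
      ((hlimK _ (ha0 (j + 1)) y).sub (hlimK _ (ha0 j) y)).const_mul (v j)))
      fun k => (h k).size v a M N₁ N₂ y hv ha0 ha hN hy
  · refine le_of_tendsto' (Filter.Tendsto.abs (tendsto_finsetSum _ fun j _ =>
      ((hlimD _ (ha0 (j + 1)) y e).sub (hlimD _ (ha0 j) y e)).const_mul (v j)))
      fun k => (h k).grad v a M N₁ N₂ y e hv ha0 ha hN hy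

end Limits

/-! ### Variation of the heat kernel and of its gradient. -/

theorem Real.sq_div_four_rpow_neg {r : ℝ} (hr : 0 < r) (k : ℕ) :
    (r ^ 2 / 4) ^ (-(k / 2 : ℝ)) = 4 ^ (k / 2 : ℝ) / r ^ k := by
  rw [Real.div_rpow (by positivity) (by norm_num), Real.rpow_neg (by positivity : (0 : ℝ) ≤ r ^ 2),
    Real.rpow_neg (by norm_num : (0 : ℝ) ≤ 4), ← Real.rpow_natCast r 2, ← Real.rpow_mul hr.le]
  have : ((2 : ℕ) : ℝ) * (k / 2 : ℝ) = k := by push_cast; ring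
  rw [this, Real.rpow_natCast]
  field_simp

/-- The constant in the bounds for the variation of the heat kernel in time. -/
noncomputable def heatConst (n : ℕ) : ℝ :=
  2 * ((n / 2 : ℝ) ^ (n / 2 : ℝ) * 4 ^ (n / 2 : ℝ)) +
    ((n / 2 + 1 : ℝ) ^ (n / 2 + 1 : ℝ) * 4 ^ (n / 2 + 1 : ℝ))

theorem heatConst_pos {n : ℕ} : 0 < heatConst n := by
  unfold heatConst
  positivity

theorem abs_sum_mul_sub_le {v : ℤ → ℝ} {M : ℝ} (hv : ∀ j, |v j| ≤ M) (f : ℤ → ℝ) {B : ℝ}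
    (s : Finset ℤ) (hB : ∑ j ∈ s, |f (j + 1) - f j| ≤ B) :
    |∑ j ∈ s, v j * (f (j + 1) - f j)| ≤ M * B := by
  have hM : 0 ≤ M := (abs_nonneg _).trans (hv 0)
  calc _ ≤ ∑ j ∈ s, |v j * (f (j + 1) - f j)| := Finset.abs_sum_le_sum_abs _ _
    _ ≤ ∑ j ∈ s, M * |f (j + 1) - f j| := Finset.sum_le_sum fun j _ => by
        rw [abs_mul]
        exact mul_le_mul_of_nonneg_right (hv j) (abs_nonneg _)
    _ ≤ _ := by
        rw [← Finset.mul_sum]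
        exact mul_le_mul_of_nonneg_left hB hM

section HeatBounds

variable {n : ℕ} {v a : ℤ → ℝ} {M : ℝ} {N₁ N₂ : ℤ} {y : Rn n}

theorem four_pi_rpow_le_one (n : ℕ) : (4 * Real.pi) ^ (-(n / 2 : ℝ)) ≤ 1 :=
  Real.rpow_le_one_of_one_le_of_nonpos (by linarith [Real.pi_gt_three])
    (neg_nonpos.2 (by positivity))

theorem abs_sum_gaussKernel_le (hn : 1 ≤ n) (hv : ∀ j, |v j| ≤ M) (ha0 : ∀ j, 0 < a j)
    (ha : Monotone a) (hN : N₁ ≤ N₂) (hy : y ≠ 0) :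
    |∑ j ∈ Finset.Icc N₁ N₂, v j * (gaussKernel (a (j + 1)) y - gaussKernel (a j) y)| ≤
      M * heatConst n / ‖y‖ ^ n := by
  have hy' : 0 < ‖y‖ := norm_pos_iff.2 hy
  have hn' : (0 : ℝ) < n / 2 := by
    have : (1 : ℝ) ≤ n := by exact_mod_cast hn
    linarith
  have h1 := sum_abs_heatProfile_sub_le hn' (r := ‖y‖ ^ 2 / 4) (by positivity) ha ha0 hN
  rw [Real.sq_div_four_rpow_neg hy'] at h1
  have h2 : ∑ j ∈ Finset.Icc N₁ N₂, |gaussKernel (a (j + 1)) y - gaussKernel (a j) y| ≤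
      heatConst n / ‖y‖ ^ n := by
    calc _ = (4 * Real.pi) ^ (-(n / 2 : ℝ)) * ∑ j ∈ Finset.Icc N₁ N₂,
          |heatProfile (n / 2) (‖y‖ ^ 2 / 4) (a (j + 1)) -
            heatProfile (n / 2) (‖y‖ ^ 2 / 4) (a j)| := by
          rw [Finset.mul_sum]
          refine Finset.sum_congr rfl fun j _ => ?_
          rw [gaussKernel, gaussKernel, ← mul_sub, abs_mul, abs_of_nonneg (by positivity)]
      _ ≤ 1 * (2 * ((n / 2 : ℝ) ^ (n / 2 : ℝ) * (4 ^ (n / 2 : ℝ) / ‖y‖ ^ n))) :=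
          mul_le_mul (four_pi_rpow_le_one n) h1
            (Finset.sum_nonneg fun j _ => abs_nonneg _) zero_le_one
      _ = 2 * ((n / 2 : ℝ) ^ (n / 2 : ℝ) * 4 ^ (n / 2 : ℝ)) / ‖y‖ ^ n := by ring
      _ ≤ _ := by
          unfold heatConst
          gcongr
          exact le_add_of_nonneg_right (by positivity)
  exact (abs_sum_mul_sub_le hv (fun j => gaussKernel (a j) y) _ h2).trans
    (le_of_eq (mul_div_assoc _ _ _).symm)

/-- The profile of exponent `n / 2 + 1` varies by a multiple of `|y|^{-(n+2)}`; the factor `⟨y, e⟩`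
of the derivative gives back one power of `|y|`. -/
theorem abs_sum_fderiv_gaussKernel_le (hv : ∀ j, |v j| ≤ M) (ha0 : ∀ j, 0 < a j)
    (ha : Monotone a) (hN : N₁ ≤ N₂) (hy : y ≠ 0) (e : Rn n) :
    |∑ j ∈ Finset.Icc N₁ N₂, v j * (fderiv ℝ (gaussKernel (a (j + 1))) y e -
      fderiv ℝ (gaussKernel (a j)) y e)| ≤ M * heatConst n / ‖y‖ ^ (n + 1) * ‖e‖ := by
  have hy' : 0 < ‖y‖ := norm_pos_iff.2 hy
  have hn' : (0 : ℝ) < n / 2 + 1 := by positivity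
  have h1 := sum_abs_heatProfile_sub_le hn' (r := ‖y‖ ^ 2 / 4) (by positivity) ha ha0 hN
  have hcast : (n / 2 + 1 : ℝ) = ((n + 2 : ℕ) : ℝ) / 2 := by push_cast; ring
  have h3 : (‖y‖ ^ 2 / 4) ^ (-(n / 2 + 1 : ℝ)) = 4 ^ (n / 2 + 1 : ℝ) / ‖y‖ ^ (n + 2) := by
    rw [hcast, Real.sq_div_four_rpow_neg hy']
  rw [h3] at h1
  have h2 : ∑ j ∈ Finset.Icc N₁ N₂, |fderiv ℝ (gaussKernel (a (j + 1))) y e -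
      fderiv ℝ (gaussKernel (a j)) y e| ≤ heatConst n / ‖y‖ ^ (n + 1) * ‖e‖ := by
    calc _ = (4 * Real.pi) ^ (-(n / 2 : ℝ)) / 2 * |inner ℝ y e| * ∑ j ∈ Finset.Icc N₁ N₂,
          |heatProfile (n / 2 + 1) (‖y‖ ^ 2 / 4) (a (j + 1)) -
            heatProfile (n / 2 + 1) (‖y‖ ^ 2 / 4) (a j)| := by
          rw [Finset.mul_sum]
          refine Finset.sum_congr rfl fun j _ => ?_
          rw [fderiv_gaussKernel_apply (ha0 _), fderiv_gaussKernel_apply (ha0 _), ← mul_sub,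
            abs_mul, abs_neg, abs_mul, abs_of_nonneg (a := (4 * Real.pi) ^ (-(n / 2 : ℝ)) / 2)
              (by positivity)]
      _ ≤ 1 / 2 * (‖y‖ * ‖e‖) * (2 * ((n / 2 + 1 : ℝ) ^ (n / 2 + 1 : ℝ) *
            (4 ^ (n / 2 + 1 : ℝ) / ‖y‖ ^ (n + 2)))) := by
          gcongr
          · exact four_pi_rpow_le_one n
          · exact abs_real_inner_le_norm y e
      _ = ((n / 2 + 1 : ℝ) ^ (n / 2 + 1 : ℝ) * 4 ^ (n / 2 + 1 : ℝ)) / ‖y‖ ^ (n + 1) * ‖e‖ := by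
          rw [pow_succ ‖y‖ (n + 1)]
          field_simp
      _ ≤ _ := by
          unfold heatConst
          gcongr
          exact le_add_of_nonneg_left (by positivity)
  refine (abs_sum_mul_sub_le hv (fun j => fderiv ℝ (gaussKernel (a j)) y e) _ h2).trans
    (le_of_eq ?_)
  ring

end HeatBounds

/-! ### Finite mixtures of heat kernels. -/

section Mixtures

variable {n : ℕ} {q : Polynomial ℝ} {h : ℝ}

/-- Without a constant term only the strictly positive times `h (i + 1)` occur, so no point mass at
the origin enters the mixture. -/
theorem Polynomial.eval_exp_eq_sum (hq0 : q.coeff 0 = 0) (h l : ℝ) :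
    q.eval (Real.exp (-(h * l))) =
      ∑ i ∈ Finset.range q.natDegree, q.coeff (i + 1) * Real.exp (-(h * (i + 1) * l)) := by
  rw [Polynomial.eval_eq_sum_range, Finset.sum_range_succ', hq0]
  simp only [zero_mul, add_zero]
  refine Finset.sum_congr rfl fun i _ => ?_
  rw [← Real.exp_nat_mul]
  congr 2
  push_cast
  ring

theorem Polynomial.sum_coeff_succ (hq0 : q.coeff 0 = 0) :
    ∑ i ∈ Finset.range q.natDegree, q.coeff (i + 1) = q.eval 1 := by
  rw [Polynomial.eval_eq_sum_range, Finset.sum_range_succ', hq0]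
  simp

theorem integrable_gauss_symbol {s : ℝ} (hs : 0 < s) :
    Integrable fun ξ : Rn n => (Real.exp (-(s * (2 * Real.pi * ‖ξ‖) ^ 2)) : ℂ) := by
  have h1 := (integrable_gaussKernel (n := n) (s := (16 * Real.pi ^ 2 * s)⁻¹)
    (by positivity)).ofReal (𝕜 := ℂ)
  have h2 := h1.const_mul ((((4 * Real.pi * (16 * Real.pi ^ 2 * s)⁻¹) ^ (-(n / 2 : ℝ)))⁻¹ : ℝ) : ℂ)
  refine h2.congr (Filter.Eventually.of_forall fun ξ => ?_)
  simp only [Complex.coe_algebraMap]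
  rw [gaussKernel_eq (by positivity), ← Complex.ofReal_mul,
    inv_mul_cancel_left₀ (by positivity)]
  congr 2
  field_simp
  ring

theorem radialKernel_mixture (hq0 : q.coeff 0 = 0) (hh : 0 < h) {τ : ℝ} (hτ : 0 < τ) :
    radialKernel (n := n) (fun l => q.eval (Real.exp (-(h * (τ * l))))) = fun y =>
      ∑ i ∈ Finset.range q.natDegree, q.coeff (i + 1) * gaussKernel (h * (i + 1) * τ) y := by
  funext y
  unfold radialKernel
  have hpos : ∀ i : ℕ, 0 < h * (i + 1) * τ := fun i => by positivity
  have e : (fun ξ : Rn n =>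
      ((q.eval (Real.exp (-(h * (τ * (2 * Real.pi * ‖ξ‖) ^ 2)))) : ℝ) : ℂ)) = fun ξ =>
      ∑ i ∈ Finset.range q.natDegree, (q.coeff (i + 1) : ℂ) *
        (Real.exp (-(h * (i + 1) * τ * (2 * Real.pi * ‖ξ‖) ^ 2)) : ℂ) := by
    funext ξ
    rw [Polynomial.eval_exp_eq_sum hq0]
    push_cast
    refine Finset.sum_congr rfl fun i _ => ?_
    congr 2
    ring
  have e2 : 𝓕 (fun ξ : Rn n => ∑ i ∈ Finset.range q.natDegree, (q.coeff (i + 1) : ℂ) *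
        (Real.exp (-(h * (i + 1) * τ * (2 * Real.pi * ‖ξ‖) ^ 2)) : ℂ)) y =
      ∑ i ∈ Finset.range q.natDegree, (q.coeff (i + 1) : ℂ) *
        𝓕 (fun ξ : Rn n => (Real.exp (-(h * (i + 1) * τ * (2 * Real.pi * ‖ξ‖) ^ 2)) : ℂ)) y := by
    simp only [Real.fourier_eq, Circle.smul_def, smul_eq_mul, Finset.mul_sum]
    rw [integral_finsetSum]
    · refine Finset.sum_congr rfl fun i _ => ?_
      rw [← integral_const_mul]
      refine integral_congr_ae (Filter.Eventually.of_forall fun ξ => ?_)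
      simp only
      ring
    · intro i _
      have := (Real.fourierIntegral_convergent_iff y).2
        ((integrable_gauss_symbol (n := n) (hpos i)).const_mul (q.coeff (i + 1) : ℂ))
      simpa only [Circle.smul_def, smul_eq_mul] using this
  rw [e, e2, Complex.re_sum]
  refine Finset.sum_congr rfl fun i _ => ?_
  rw [fourier_gauss (hpos i), ← Complex.ofReal_mul, Complex.ofReal_re]

/-- For each `i` the times `h (i + 1) a_j` again form a positive increasing sequence, so the heat
kernel bound applies with a constant independent of `i`. The weights are nonnegative with sum at
most one, so averaging keeps that constant. -/
theorem isSubordinate_mixture (hn : 1 ≤ n) (hq : ∀ i, 0 ≤ q.coeff i) (hq0 : q.coeff 0 = 0)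
    (hq1 : q.eval 1 ≤ 1) (hh : 0 < h) :
    IsSubordinate n (heatConst n) fun l => q.eval (Real.exp (-(h * l))) := by
  have hpos : ∀ (i : ℕ) {τ : ℝ}, 0 < τ → 0 < h * (i + 1) * τ := fun i τ hτ => by positivity
  have havg : ∀ (f : ℕ → ℝ) (B : ℝ), 0 ≤ B → (∀ i, |f i| ≤ B) →
      |∑ i ∈ Finset.range q.natDegree, q.coeff (i + 1) * f i| ≤ B := fun f B hB hf => by
    calc _ ≤ ∑ i ∈ Finset.range q.natDegree, |q.coeff (i + 1) * f i| :=
          Finset.abs_sum_le_sum_abs _ _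
      _ ≤ ∑ i ∈ Finset.range q.natDegree, q.coeff (i + 1) * B :=
          Finset.sum_le_sum fun i _ => by
            rw [abs_mul, abs_of_nonneg (hq _)]
            exact mul_le_mul_of_nonneg_left (hf i) (hq _)
      _ ≤ 1 * B := by
          rw [← Finset.sum_mul, Polynomial.sum_coeff_succ hq0]
          exact mul_le_mul_of_nonneg_right hq1 hB
      _ = B := one_mul B
  have hswap : ∀ (v : ℤ → ℝ) (s : Finset ℤ) (f g : ℤ → ℕ → ℝ),
      ∑ j ∈ s, v j * (∑ i ∈ Finset.range q.natDegree, q.coeff (i + 1) * f j i -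
        ∑ i ∈ Finset.range q.natDegree, q.coeff (i + 1) * g j i) =
      ∑ i ∈ Finset.range q.natDegree, q.coeff (i + 1) * ∑ j ∈ s, v j * (f j i - g j i) :=
    fun v s f g => by
      simp only [← Finset.sum_sub_distrib, Finset.mul_sum]
      rw [Finset.sum_comm]
      refine Finset.sum_congr rfl fun i _ => Finset.sum_congr rfl fun j _ => ?_
      ring
  have hfd : ∀ τ, 0 < τ → ∀ y e : Rn n,
      fderiv ℝ (radialKernel (n := n) fun l => q.eval (Real.exp (-(h * (τ * l))))) y e =
      ∑ i ∈ Finset.range q.natDegree, q.coeff (i + 1) *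
        fderiv ℝ (gaussKernel (n := n) (h * (i + 1) * τ)) y e := fun τ hτ y e => by
    rw [radialKernel_mixture hq0 hh hτ]
    have : HasFDerivAt (fun y : Rn n => ∑ i ∈ Finset.range q.natDegree,
        q.coeff (i + 1) * gaussKernel (h * (i + 1) * τ) y) (∑ i ∈ Finset.range q.natDegree,
        q.coeff (i + 1) • fderiv ℝ (gaussKernel (n := n) (h * (i + 1) * τ)) y) y :=
      HasFDerivAt.fun_sum fun i _ =>
        ((hasFDerivAt_gaussKernel (hpos i hτ) y).differentiableAt.hasFDerivAt).const_mul _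
    rw [this.fderiv]
    simp
  refine ⟨fun τ hτ y => ?_, fun τ hτ => ?_, fun v a M N₁ N₂ y hv ha0 ha hN hy => ?_,
    fun v a M N₁ N₂ y e hv ha0 ha hN hy => ?_⟩
  · rw [radialKernel_mixture hq0 hh hτ]
    exact Finset.sum_nonneg fun i _ => mul_nonneg (hq _) (gaussKernel_nonneg (hpos i hτ) y)
  · rw [radialKernel_mixture hq0 hh hτ]
    have hi : ∀ i ∈ Finset.range q.natDegree, Integrable fun y : Rn n =>
        q.coeff (i + 1) * gaussKernel (h * (i + 1) * τ) y := fun i _ =>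
      (integrable_gaussKernel (hpos i hτ)).const_mul _
    rw [← ofReal_integral_eq_lintegral_ofReal (integrable_finsetSum _ hi)
      (Filter.Eventually.of_forall fun y => Finset.sum_nonneg fun i _ =>
        mul_nonneg (hq _) (gaussKernel_nonneg (hpos i hτ) y)), integral_finsetSum _ hi]
    simp only [integral_const_mul, integral_gaussKernel (hpos _ hτ), mul_one]
    rw [Polynomial.sum_coeff_succ hq0]
    exact ENNReal.ofReal_le_one.2 hq1
  · have hM : 0 ≤ M := (abs_nonneg _).trans (hv 0)
    simp only [radialKernel_mixture hq0 hh (ha0 _)]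
    rw [hswap]
    refine havg _ _ (div_nonneg (mul_nonneg hM heatConst_pos.le) (by positivity)) fun i => ?_
    exact abs_sum_gaussKernel_le (a := fun j => h * (i + 1) * a j) hn hv (fun j => hpos i (ha0 j))
      (ha.const_mul (by positivity)) hN hy
  · have hM : 0 ≤ M := (abs_nonneg _).trans (hv 0)
    simp only [hfd _ (ha0 _)]
    rw [hswap]
    refine havg _ _ (mul_nonneg (div_nonneg (mul_nonneg hM heatConst_pos.le) (by positivity))
      (norm_nonneg e)) fun i => ?_
    exact abs_sum_fderiv_gaussKernel_le (a := fun j => h * (i + 1) * a j) hv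
      (fun j => hpos i (ha0 j)) (ha.const_mul (by positivity)) hN hy e

end Mixtures

theorem isSubordinate_stable {n : ℕ} (hn : 1 ≤ n) {α : ℝ} (h0 : 0 < α) (h1 : α < 1) :
    IsSubordinate n (heatConst n) fun l => Real.exp (-l ^ α) :=
  stable_induction h0 h1 _ (fun _ _ hq hq0 hq1 hh => isSubordinate_mixture hn hq hq0 hq1 hh)
    fun _ _ hF hb hlim h => IsSubordinate.of_tendsto hn h0 hF hb hlim h

/-! ### Convolution with an integrable kernel on `L^p`. -/

section Convolution

variable {V : Type*} [NormedAddCommGroup V] [InnerProductSpace ℝ V] [FiniteDimensional ℝ V]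
  [MeasurableSpace V] [BorelSpace V] {p q : ℝ≥0∞} {P f g : V → ℂ}

theorem aestronglyMeasurable_mul_comp_sub (hP : AEStronglyMeasurable P volume)
    (hf : AEStronglyMeasurable f volume) :
    AEStronglyMeasurable (fun z : V × V => P z.1 * f (z.2 - z.1)) (volume.prod volume) :=
  (AEStronglyMeasurable.convolution_integrand (ContinuousLinearMap.mul ℝ ℂ) hP hf).prod_swap

theorem integrable_mul_comp_sub_mul [p.HolderConjugate q] (hP : Integrable P)
    (hf : MemLp f p volume) (hg : MemLp g q volume) :
    Integrable (fun z : V × V => P z.1 * f (z.2 - z.1) * g z.2) (volume.prod volume) := by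
  have hm : AEStronglyMeasurable (fun z : V × V => P z.1 * f (z.2 - z.1) * g z.2)
      (volume.prod volume) := (aestronglyMeasurable_mul_comp_sub hP.1 hf.1).mul hg.1.comp_snd
  have hfy : ∀ y, MemLp (fun x => f (x - y)) p volume := fun y =>
    hf.comp_measurePreserving (measurePreserving_sub_right volume y)
  have hi : ∀ y, Integrable fun x => f (x - y) * g x := fun y => (hfy y).integrable_mul hg
  rw [integrable_prod_iff hm]
  refine ⟨Filter.Eventually.of_forall fun y => ?_,
    (hP.norm.mul_const (eLpNorm f p volume * eLpNorm g q volume).toReal).mono'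
      hm.norm.integral_prod_right' (Filter.Eventually.of_forall fun y => ?_)⟩
  · simp only [mul_assoc]
    exact (hi y).const_mul _
  · rw [Real.norm_of_nonneg (integral_nonneg fun x => norm_nonneg _)]
    simp only [mul_assoc, norm_mul (P y)]
    rw [integral_const_mul]
    gcongr
    rw [integral_norm_eq_lintegral_enorm (hi y).1]
    refine ENNReal.toReal_mono (ENNReal.mul_ne_top hf.eLpNorm_ne_top hg.eLpNorm_ne_top) ?_
    rw [← eLpNorm_one_eq_lintegral_enorm]
    calc _ ≤ eLpNorm (fun x => f (x - y)) p volume * eLpNorm g q volume :=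
          eLpNorm_smul_le_mul_eLpNorm (r := 1) hg.1 (hfy y).1
      _ = _ := by
          congr 1
          exact eLpNorm_comp_measurePreserving hf.1 (measurePreserving_sub_right volume y)

/-- Indicators of balls lie in the dual space for every exponent, so Fubini gives integrability for
almost every `x` in each ball, including when `p = ∞`. -/
theorem ae_integrable_mul_comp_sub (hp : 1 ≤ p) (hP : Integrable P) (hf : MemLp f p volume) :
    ∀ᵐ x, Integrable fun y => P y * f (x - y) := by
  have := ENNReal.HolderConjugate.conjExponent hp
  have h : ∀ R : ℕ, ∀ᵐ x, Integrable fun y =>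
      P y * f (x - y) * (Metric.ball (0 : V) R).indicator (fun _ => (1 : ℂ)) x := fun R =>
    (integrable_mul_comp_sub_mul hP hf (memLp_indicator_const p.conjExponent
      Metric.isOpen_ball.measurableSet 1 (Or.inr measure_ball_lt_top.ne))).prod_left_ae
  filter_upwards [ae_all_iff.2 h] with x hx
  obtain ⟨R, hR⟩ := exists_nat_gt ‖x‖
  simpa [hR] using hx R

/-- Fubini's theorem combined with the measure-preserving shear `(y, x) ↦ (y, y + x)`. -/
theorem integral_integral_mul_comp_sub [p.HolderConjugate q] (hP : Integrable P)
    (hf : MemLp f p volume) (hg : MemLp g q volume) :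
    ∫ x, (∫ y, P y * f (x - y)) * g x = ∫ x, f x * ∫ y, P y * g (x + y) := by
  have h1 := integrable_mul_comp_sub_mul hP hf hg
  have hT := measurePreserving_prod_add (volume : Measure V) (volume : Measure V)
  have hE : MeasurableEmbedding fun z : V × V => (z.1, z.1 + z.2) :=
    (MeasurableEquiv.shearAddRight V).measurableEmbedding
  have h2 := (hT.integrable_comp_emb hE).2 h1
  have h3 := (integral_prod_symm _ h2).symm.trans
    ((hT.integral_comp hE _).trans (integral_prod_symm _ h1))
  simp only [Function.comp, add_sub_cancel_left] at h3
  calc _ = ∫ x, ∫ y, P y * f (x - y) * g x := by simp only [integral_mul_const]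
    _ = ∫ x, ∫ y, P y * f x * g (y + x) := h3.symm
    _ = _ := by
        refine integral_congr_ae (Filter.Eventually.of_forall fun x => ?_)
        simp only
        rw [← integral_const_mul]
        refine integral_congr_ae (Filter.Eventually.of_forall fun y => ?_)
        simp only
        rw [add_comm y x]
        ring

/-- **Young's convolution inequality** for a kernel of mass at most one. -/
theorem memLp_integral_mul_comp_sub (hp : 1 ≤ p) (hP : Integrable P) (hP1 : ∫⁻ y, ‖P y‖ₑ ≤ 1)
    (hf : MemLp f p volume) : MemLp (fun x => ∫ y, P y * f (x - y)) p volume := by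
  have hm := aestronglyMeasurable_mul_comp_sub hP.1 hf.1
  have hmc : AEStronglyMeasurable (fun x => ∫ y, P y * f (x - y)) volume :=
    hm.prod_swap.integral_prod_right'
  refine ⟨hmc, ?_⟩
  -- The kernel is absorbed into a measure of mass at most one, on which the `L^1` norm is dominated
  -- by the `L^p` norm; this plays the role of Jensen's inequality.
  set ν : Measure V := volume.withDensity fun y => ‖P y‖ₑ with hν
  have hν1 : ν Set.univ ≤ 1 := by
    rw [hν, withDensity_apply _ MeasurableSet.univ, Measure.restrict_univ]
    exact hP1
  have hac : ν ≪ volume := withDensity_absolutelyContinuous _ _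
  have hfx : ∀ x, AEStronglyMeasurable (fun y => f (x - y)) volume := fun x =>
    hf.1.comp_measurePreserving (Measure.measurePreserving_sub_left volume x)
  have hjensen : ∀ x, ‖∫ y, P y * f (x - y)‖ₑ ≤ eLpNorm (fun y => f (x - y)) p ν := fun x => by
    calc ‖∫ y, P y * f (x - y)‖ₑ ≤ ∫⁻ y, ‖P y * f (x - y)‖ₑ := enorm_integral_le_lintegral_enorm _
      _ = eLpNorm (fun y => f (x - y)) 1 ν := by
          rw [eLpNorm_one_eq_lintegral_enorm, hν,
            lintegral_withDensity_eq_lintegral_mul₀ hP.1.enorm (hfx x).enorm]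
          simp [enorm_mul]
      _ ≤ eLpNorm (fun y => f (x - y)) p ν * ν Set.univ ^ (1 / (1 : ℝ≥0∞).toReal - 1 / p.toReal) :=
          eLpNorm_le_eLpNorm_mul_rpow_measure_univ hp ((hfx x).mono_ac hac)
      _ ≤ eLpNorm (fun y => f (x - y)) p ν * 1 := by
          gcongr
          refine ENNReal.rpow_le_one hν1 ?_
          rcases eq_or_ne p ∞ with rfl | hpt
          · simp
          · have : 1 ≤ p.toReal := by
              rw [← ENNReal.toReal_one]; exact ENNReal.toReal_mono hpt hp
            have := (div_le_one (by linarith)).2 this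
            simpa using this
      _ = _ := mul_one _
  rcases eq_or_ne p ∞ with rfl | hpt
  · refine lt_of_le_of_lt (eLpNorm_le_of_ae_enorm_bound (C := eLpNorm f ∞ volume) ?_) ?_
    · refine Filter.Eventually.of_forall fun x => (hjensen x).trans ?_
      rw [← eLpNorm_comp_measurePreserving hf.1 (Measure.measurePreserving_sub_left volume x)]
      simp only [eLpNorm_exponent_top]
      exact essSup_mono_measure hac
    · simpa using hf.2
  · have hp0 : p ≠ 0 := (zero_lt_one.trans_le hp).ne'
    have hpr : 0 < p.toReal := ENNReal.toReal_pos hp0 hpt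
    rw [eLpNorm_lt_top_iff_lintegral_rpow_enorm_lt_top hp0 hpt]
    have hfin := (eLpNorm_lt_top_iff_lintegral_rpow_enorm_lt_top hp0 hpt).1 hf.2
    calc ∫⁻ x, ‖∫ y, P y * f (x - y)‖ₑ ^ p.toReal
        ≤ ∫⁻ x, ∫⁻ y, ‖P y‖ₑ * ‖f (x - y)‖ₑ ^ p.toReal := by
          refine lintegral_mono fun x => ?_
          refine (ENNReal.rpow_le_rpow (hjensen x) hpr.le).trans ?_
          rw [eLpNorm_eq_lintegral_rpow_enorm_toReal hp0 hpt, ← ENNReal.rpow_mul,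
            one_div_mul_cancel hpr.ne', ENNReal.rpow_one, hν,
            lintegral_withDensity_eq_lintegral_mul₀ hP.1.enorm ((hfx x).enorm.pow_const _)]
          rfl
      _ = ∫⁻ y, ∫⁻ x, ‖P y‖ₑ * ‖f (x - y)‖ₑ ^ p.toReal := by
          refine lintegral_lintegral_swap (hP.1.enorm.comp_snd.mul (AEMeasurable.pow_const ?_ _))
          exact (hf.1.comp_quasiMeasurePreserving
            (quasiMeasurePreserving_sub (volume : Measure V) volume)).enorm
      _ = ∫⁻ y, ‖P y‖ₑ * ∫⁻ x, ‖f x‖ₑ ^ p.toReal := by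
          refine lintegral_congr fun y => ?_
          rw [lintegral_const_mul' _ _ enorm_ne_top]
          congr 1
          exact lintegral_sub_right_eq_self (fun x => ‖f x‖ₑ ^ p.toReal) y
      _ ≤ 1 * ∫⁻ x, ‖f x‖ₑ ^ p.toReal := by
          rw [lintegral_mul_const' _ _ hfin.ne]
          gcongr
      _ < ∞ := by rwa [one_mul]

/-- The exchange formula `∫ 𝓕P · G = ∫ P · 𝓕G` is applied to `g` modulated by the character at `x`;
modulation translates its Fourier transform by `x`. -/
theorem fourier_fourier_mul (hP : Integrable P) (hg : Integrable g) (x : V) :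
    𝓕 (fun ξ => 𝓕 P ξ * g ξ) x = ∫ y, P y * 𝓕 g (x + y) := by
  have hg' : Integrable fun ξ => Complex.exp (↑(-2 * Real.pi * inner ℝ ξ x) * Complex.I) * g ξ :=
    hg.bdd_mul (c := 1) (Continuous.aestronglyMeasurable (by fun_prop))
      (Filter.Eventually.of_forall fun ξ => (Complex.norm_exp_ofReal_mul_I _).le)
  have h : ∫ ξ, 𝓕 P ξ * (Complex.exp (↑(-2 * Real.pi * inner ℝ ξ x) * Complex.I) * g ξ) =
      ∫ y, P y * 𝓕 (fun ξ => Complex.exp (↑(-2 * Real.pi * inner ℝ ξ x) * Complex.I) * g ξ) y := by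
    simpa using! VectorFourier.integral_fourierIntegral_smul_eq_flip (L := innerₗ V)
      (μ := volume) (ν := volume) Real.continuous_fourierChar continuous_inner hP hg'
  have hshift : ∀ y,
      𝓕 (fun ξ => Complex.exp (↑(-2 * Real.pi * inner ℝ ξ x) * Complex.I) * g ξ) y =
        𝓕 g (x + y) := fun y => by
    simp only [Real.fourier_eq', smul_eq_mul, ← mul_assoc, ← Complex.exp_add, inner_add_right]
    refine integral_congr_ae (Filter.Eventually.of_forall fun ξ => ?_)
    simp only
    congr 2
    push_cast
    ring
  simp only [hshift] at h
  rw [← h, Real.fourier_eq']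
  refine integral_congr_ae (Filter.Eventually.of_forall fun ξ => ?_)
  simp only [smul_eq_mul]
  ring

/-- Every smooth compactly supported function is the Fourier transform of a Schwartz function, so
the hypothesis tests `f - g` against all of them. -/
theorem ae_eq_of_integral_mul_fourier_eq (hp : 1 ≤ p) (hf : MemLp f p volume)
    (hg : MemLp g p volume)
    (h : ∀ ψ : 𝓢(V, ℂ), ∫ x, f x * 𝓕 (fun ξ => ψ ξ) x = ∫ x, g x * 𝓕 (fun ξ => ψ ξ) x) :
    f =ᵐ[volume] g := by
  have := ENNReal.HolderConjugate.conjExponent hp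
  have hd : ∀ᵐ x, (f - g) x = 0 := by
    refine ae_eq_zero_of_integral_contDiff_smul_eq_zero ((hf.sub hg).locallyIntegrable hp)
      fun w hw hwc => ?_
    have hwc' : HasCompactSupport fun x => (w x : ℂ) := hwc.comp_left Complex.ofReal_zero
    set W : 𝓢(V, ℂ) := hwc'.toSchwartzMap (Complex.ofRealCLM.contDiff.comp hw) with hW
    have hWa : ∀ x, W x = w x := fun x => rfl
    have hF : 𝓕 (fun ξ : V => (𝓕⁻ W : 𝓢(V, ℂ)) ξ) = fun x : V => (w x : ℂ) := by
      have e : 𝓕 (𝓕⁻ W) = W := FourierTransform.fourier_fourierInv_eq W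
      have := congrArg (fun S : 𝓢(V, ℂ) => (S : V → ℂ)) e
      simp only [SchwartzMap.fourier_coe] at this
      exact this
    have h' := h (𝓕⁻ W)
    rw [hF] at h'
    have hwL : MemLp (fun x => (w x : ℂ)) p.conjExponent volume := by
      have := W.memLp p.conjExponent
      rwa [show (W : V → ℂ) = fun x => (w x : ℂ) from funext hWa] at this
    have hi1 : Integrable fun x => f x * (w x : ℂ) := hf.integrable_mul hwL
    have hi2 : Integrable fun x => g x * (w x : ℂ) := hg.integrable_mul hwL
    calc ∫ x, w x • (f - g) x = ∫ x, (f x * w x - g x * w x) := by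
          refine integral_congr_ae (Filter.Eventually.of_forall fun x => ?_)
          simp only [Pi.sub_apply, Complex.real_smul]
          ring
      _ = 0 := by rw [integral_sub hi1 hi2, h', sub_self]
  filter_upwards [hd] with x hx
  exact sub_eq_zero.1 hx

end Convolution

/-! ### The fractional heat semigroup and the differential transforms. -/

section FractionalHeat

variable {n : ℕ} {α t : ℝ}

theorem fracHeatSymbol_eq (t : ℝ) (ξ : Rn n) :
    fracHeatSymbol α t ξ = Real.exp (-(t * (2 * Real.pi) ^ (2 * α)) * ‖ξ‖ ^ (2 * α)) := by
  rw [fracHeatSymbol, Real.mul_rpow (by positivity) (norm_nonneg ξ)]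
  congr 1
  ring

theorem continuous_fracHeatSymbol (h0 : 0 < α) (t : ℝ) :
    Continuous (fracHeatSymbol (n := n) α t) := by
  unfold fracHeatSymbol
  have : Continuous fun ξ : Rn n => (2 * Real.pi * ‖ξ‖) ^ (2 * α) :=
    Continuous.rpow_const (by fun_prop) fun _ => Or.inr (by linarith)
  fun_prop

theorem integrable_norm_pow_mul_fracHeatSymbol (hn : 1 ≤ n) (h0 : 0 < α) (ht : 0 < t) (m : ℕ) :
    Integrable fun ξ : Rn n => ‖ξ‖ ^ m * fracHeatSymbol α t ξ := by
  simp only [fracHeatSymbol_eq]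
  exact integrable_norm_pow_mul_exp_neg_mul_rpow hn m
    (mul_pos ht (Real.rpow_pos_of_pos (by positivity) _)) (by linarith)

theorem integrable_fracHeatSymbol (hn : 1 ≤ n) (h0 : 0 < α) (ht : 0 < t) :
    Integrable fun ξ : Rn n => (fracHeatSymbol α t ξ : ℂ) := by
  simpa using (integrable_norm_pow_mul_fracHeatSymbol hn h0 ht 0).ofReal (𝕜 := ℂ)

theorem fracHeatKernel_eq_re_fourier (α t : ℝ) :
    fracHeatKernel (n := n) α t = fun y => (𝓕 (fun ξ : Rn n => (fracHeatSymbol α t ξ : ℂ)) y).re := by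
  funext y
  unfold fracHeatKernel
  rw [Real.fourierInv_eq_fourier_comp_neg]
  simp [fracHeatSymbol]

theorem differentiable_fracHeatKernel (hn : 1 ≤ n) (h0 : 0 < α) (ht : 0 < t) :
    Differentiable ℝ (fracHeatKernel (n := n) α t) := by
  rw [fracHeatKernel_eq_re_fourier]
  refine fun y => (hasFDerivAt_re_fourier (integrable_fracHeatSymbol hn h0 ht) ?_ y).differentiableAt
  refine (integrable_norm_pow_mul_fracHeatSymbol hn h0 ht 1).congr
    (Filter.Eventually.of_forall fun ξ => ?_)
  simp only [pow_one, Complex.norm_real, Real.norm_of_nonneg (Real.exp_pos _).le, fracHeatSymbol]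

theorem fracHeatKernel_nonneg (hn : 1 ≤ n) (h0 : 0 < α) (h1 : α < 1) (ht : 0 < t) (y : Rn n) :
    0 ≤ fracHeatKernel α t y := by
  rw [fracHeatKernel_eq_radialKernel h0 ht]
  exact (isSubordinate_stable hn h0 h1).nonneg _ (Real.rpow_pos_of_pos ht _) y

theorem lintegral_enorm_fracHeatKernel_le (hn : 1 ≤ n) (h0 : 0 < α) (h1 : α < 1) (ht : 0 < t) :
    ∫⁻ y : Rn n, ‖(fracHeatKernel α t y : ℂ)‖ₑ ≤ 1 := by
  refine le_trans (le_of_eq (lintegral_congr fun y => ?_))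
    ((isSubordinate_stable hn h0 h1).mass _ (Real.rpow_pos_of_pos ht α⁻¹))
  rw [← fracHeatKernel_eq_radialKernel h0 ht, ← ofReal_norm, Complex.norm_real,
    Real.norm_of_nonneg (fracHeatKernel_nonneg hn h0 h1 ht y)]

theorem integrable_fracHeatKernel (hn : 1 ≤ n) (h0 : 0 < α) (h1 : α < 1) (ht : 0 < t) :
    Integrable fun y : Rn n => (fracHeatKernel α t y : ℂ) :=
  ⟨(Complex.continuous_ofReal.comp
    (differentiable_fracHeatKernel hn h0 ht).continuous).aestronglyMeasurable,
    (lintegral_enorm_fracHeatKernel_le hn h0 h1 ht).trans_lt ENNReal.one_lt_top⟩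

/-- Fourier inversion needs the transform of the symbol to be integrable; subordination provides
this, as the kernel is nonnegative with mass at most one. -/
theorem fourier_fracHeatKernel (hn : 1 ≤ n) (h0 : 0 < α) (h1 : α < 1) (ht : 0 < t) :
    𝓕 (fun y : Rn n => (fracHeatKernel α t y : ℂ)) = fun ξ => (fracHeatSymbol α t ξ : ℂ) := by
  have e : (fun y : Rn n => (fracHeatKernel α t y : ℂ)) =
      𝓕⁻ (fun ξ : Rn n => (fracHeatSymbol α t ξ : ℂ)) := funext (ofReal_fracHeatKernel α t)
  have e' : 𝓕 (fun ξ : Rn n => (fracHeatSymbol α t ξ : ℂ)) =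
      𝓕⁻ (fun ξ : Rn n => (fracHeatSymbol α t ξ : ℂ)) := by
    funext y
    rw [Real.fourierInv_eq_fourier_comp_neg]
    simp [fracHeatSymbol]
  rw [e]
  refine (Complex.continuous_ofReal.comp (continuous_fracHeatSymbol h0 t)).fourier_fourierInv_eq
    (integrable_fracHeatSymbol hn h0 ht) ?_
  have := integrable_fracHeatKernel hn h0 h1 ht
  rw [e, ← e'] at this
  exact this

variable {p : ℝ≥0∞} {f : Rn n → ℂ}

/-- Moving the convolution onto `𝓕ψ` yields `∫ P(y) 𝓕ψ(x + y) dy`, which is `𝓕(𝓕P · ψ)(x)`, and `𝓕P`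
is the symbol. -/
theorem isFracHeat_convolution (hn : 1 ≤ n) (h0 : 0 < α) (h1 : α < 1) (ht : 0 < t) (hp : 1 ≤ p)
    (hf : MemLp f p volume) :
    IsFracHeat p α t f fun x => ∫ y, (fracHeatKernel α t y : ℂ) * f (x - y) := by
  have hP := integrable_fracHeatKernel hn h0 h1 ht
  refine ⟨memLp_integral_mul_comp_sub hp hP (lintegral_enorm_fracHeatKernel_le hn h0 h1 ht) hf,
    fun ψ => ?_⟩
  have := ENNReal.HolderConjugate.conjExponent hp
  have hψ : MemLp (𝓕 fun ξ : Rn n => ψ ξ) p.conjExponent volume := by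
    have := (𝓕 ψ).memLp p.conjExponent (volume : Measure (Rn n))
    rwa [SchwartzMap.fourier_coe] at this
  rw [integral_integral_mul_comp_sub hP hf hψ]
  refine integral_congr_ae (Filter.Eventually.of_forall fun x => ?_)
  simp only
  rw [← fourier_fourier_mul hP ψ.integrable x, fourier_fracHeatKernel hn h0 h1 ht]

theorem isFracHeat_fracHeat (hn : 1 ≤ n) (h0 : 0 < α) (h1 : α < 1) (ht : 0 < t) (hp : 1 ≤ p)
    (hf : MemLp f p volume) : IsFracHeat p α t f (fracHeat p α t f) := by
  have h : ∃ u, IsFracHeat p α t f u := ⟨_, isFracHeat_convolution hn h0 h1 ht hp hf⟩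
  rw [fracHeat, dif_pos h]
  exact h.choose_spec

theorem fracHeat_ae_eq_convolution (hn : 1 ≤ n) (h0 : 0 < α) (h1 : α < 1) (ht : 0 < t)
    (hp : 1 ≤ p) (hf : MemLp f p volume) :
    fracHeat p α t f =ᵐ[volume] fun x => ∫ y, (fracHeatKernel α t y : ℂ) * f (x - y) := by
  have hu := isFracHeat_fracHeat hn h0 h1 ht hp hf
  have hw := isFracHeat_convolution hn h0 h1 ht hp hf
  exact ae_eq_of_integral_mul_fourier_eq hp hu.memLp hw.memLp fun ψ =>
    (hu.fourier_eq ψ).trans (hw.fourier_eq ψ).symm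

variable {v a : ℤ → ℝ} {N : ℤ × ℤ}

theorem ae_diffTransform_eq (hn : 1 ≤ n) (h0 : 0 < α) (h1 : α < 1) (ha : ∀ j, 0 < a j)
    (hp : 1 ≤ p) (hf : MemLp f p volume) :
    ∀ᵐ x : Rn n, Integrable (fun y : Rn n => (diffKernel α v a N y : ℂ) * f (x - y)) ∧
      diffTransform p α v a N f x = ∫ y : Rn n, (diffKernel α v a N y : ℂ) * f (x - y) := by
  filter_upwards [ae_all_iff.2 fun j =>
      ae_integrable_mul_comp_sub hp (integrable_fracHeatKernel hn h0 h1 (ha j)) hf,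
    ae_all_iff.2 fun j => fracHeat_ae_eq_convolution hn h0 h1 (ha j) hp hf] with x hi he
  have e : (fun y : Rn n => (diffKernel α v a N y : ℂ) * f (x - y)) = fun y =>
      ∑ j ∈ Finset.Icc N.1 N.2, (v j : ℂ) * ((fracHeatKernel α (a (j + 1)) y : ℂ) * f (x - y) -
        (fracHeatKernel α (a j) y : ℂ) * f (x - y)) := by
    funext y
    simp only [diffKernel]
    push_cast
    rw [Finset.sum_mul]
    exact Finset.sum_congr rfl fun j _ => by ring
  have hj : ∀ j ∈ Finset.Icc N.1 N.2, Integrable fun y : Rn n =>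
      (v j : ℂ) * ((fracHeatKernel α (a (j + 1)) y : ℂ) * f (x - y) -
        (fracHeatKernel α (a j) y : ℂ) * f (x - y)) := fun j _ =>
    ((hi (j + 1)).sub (hi j)).const_mul _
  rw [e]
  refine ⟨integrable_finsetSum _ hj, ?_⟩
  rw [integral_finsetSum _ hj, diffTransform]
  refine Finset.sum_congr rfl fun j _ => ?_
  rw [integral_const_mul, integral_sub (hi (j + 1)) (hi j), he, he]

theorem monotone_rpow_inv (h0 : 0 < α) (ha0 : ∀ j, 0 < a j) (ha : Monotone a) :
    Monotone fun j => a j ^ α⁻¹ := fun i _ hij =>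
  Real.rpow_le_rpow (ha0 i).le (ha hij) (inv_nonneg.2 h0.le)

theorem abs_diffKernel_le (hn : 1 ≤ n) (h0 : 0 < α) (h1 : α < 1) {M : ℝ} (hv : ∀ j, |v j| ≤ M)
    (ha0 : ∀ j, 0 < a j) (ha : Monotone a) (hN : N.1 ≤ N.2) {y : Rn n} (hy : y ≠ 0) :
    |diffKernel α v a N y| ≤ M * heatConst n / ‖y‖ ^ n := by
  unfold diffKernel
  simp only [fracHeatKernel_eq_radialKernel h0 (ha0 _)]
  exact (isSubordinate_stable hn h0 h1).size v (fun j => a j ^ α⁻¹) M N.1 N.2 y hv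
    (fun j => Real.rpow_pos_of_pos (ha0 j) _) (monotone_rpow_inv h0 ha0 ha) hN hy

theorem hasFDerivAt_diffKernel (hn : 1 ≤ n) (h0 : 0 < α) (ha0 : ∀ j, 0 < a j) (y : Rn n) :
    HasFDerivAt (diffKernel (n := n) α v a N) (∑ j ∈ Finset.Icc N.1 N.2,
      v j • (fderiv ℝ (fracHeatKernel (n := n) α (a (j + 1))) y -
        fderiv ℝ (fracHeatKernel (n := n) α (a j)) y)) y :=
  HasFDerivAt.fun_sum fun j _ =>
    ((differentiable_fracHeatKernel hn h0 (ha0 (j + 1)) y).hasFDerivAt.sub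
      (differentiable_fracHeatKernel hn h0 (ha0 j) y).hasFDerivAt).const_mul (v j)

theorem norm_gradient_diffKernel_le (hn : 1 ≤ n) (h0 : 0 < α) (h1 : α < 1) {M : ℝ}
    (hv : ∀ j, |v j| ≤ M) (ha0 : ∀ j, 0 < a j) (ha : Monotone a) (hN : N.1 ≤ N.2) {y : Rn n}
    (hy : y ≠ 0) :
    ‖gradient (diffKernel (n := n) α v a N) y‖ ≤ M * heatConst n / ‖y‖ ^ (n + 1) := by
  have hM : 0 ≤ M := (abs_nonneg _).trans (hv 0)
  -- The Riesz isometry turns the gradient into the derivative, whose norm is bounded by testing on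
  -- every direction `e`.
  rw [gradient, LinearIsometryEquiv.norm_map, (hasFDerivAt_diffKernel hn h0 ha0 y).fderiv]
  refine ContinuousLinearMap.opNorm_le_bound _
    (div_nonneg (mul_nonneg hM heatConst_pos.le) (by positivity)) fun e => ?_
  have := (isSubordinate_stable hn h0 h1).grad v (fun j => a j ^ α⁻¹) M N.1 N.2 y e hv
    (fun j => Real.rpow_pos_of_pos (ha0 j) _) (monotone_rpow_inv h0 ha0 ha) hN hy
  simp only [← fracHeatKernel_eq_radialKernel h0 (ha0 _)] at this
  simpa using this

end FractionalHeat

theorem proposition2 (n : ℕ) (hn : 1 ≤ n) (α : ℝ) (hα₀ : 0 < α) (hα₁ : α < 1) (M : ℝ) :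
    ∃ C : ℝ, 0 < C ∧
      ∀ v a : ℤ → ℝ, (∀ j, |v j| ≤ M) → (∀ j, 0 < a j) → Monotone a →
      ∀ N : ℤ × ℤ, N.1 < N.2 →
        (∀ (p : ℝ≥0∞) (f : Rn n → ℂ), 1 ≤ p → MemLp f p volume →
          (∀ j, IsFracHeat p α (a j) f (fracHeat p α (a j) f)) ∧
          ∀ᵐ x : Rn n, Integrable (fun y : Rn n => (diffKernel α v a N y : ℂ) * f (x - y)) ∧
            diffTransform p α v a N f x =
              ∫ y : Rn n, (diffKernel α v a N y : ℂ) * f (x - y)) ∧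
        ∀ y : Rn n, y ≠ 0 →
          |diffKernel α v a N y| ≤ C / ‖y‖ ^ n ∧
          DifferentiableAt ℝ (diffKernel (n := n) α v a N) y ∧
          ‖gradient (diffKernel (n := n) α v a N) y‖ ≤ C / ‖y‖ ^ (n + 1) := by
  have hC : M * heatConst n ≤ |M| * heatConst n + 1 := by
    have := mul_le_mul_of_nonneg_right (le_abs_self M) (heatConst_pos (n := n)).le
    linarith
  -- `M` is an arbitrary real number; the absolute value and the added `1` make the constant
  -- positive in all cases.
  refine ⟨|M| * heatConst n + 1,
    add_pos_of_nonneg_of_pos (mul_nonneg (abs_nonneg M) heatConst_pos.le) one_pos,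
    fun v a hv ha0 ha N hN => ⟨fun p f hp hf =>
      ⟨fun j => isFracHeat_fracHeat hn hα₀ hα₁ (ha0 j) hp hf,
        ae_diffTransform_eq hn hα₀ hα₁ ha0 hp hf⟩, fun y hy => ⟨?_, ?_, ?_⟩⟩⟩
  · refine (abs_diffKernel_le hn hα₀ hα₁ hv ha0 ha hN.le hy).trans ?_
    gcongr
  · exact (hasFDerivAt_diffKernel hn hα₀ ha0 y).differentiableAt
  · refine (norm_gradient_diffKernel_le hn hα₀ hα₁ hv ha0 ha hN.le hy).trans ?_
    gcongr
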